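/- **Theorem (Lower bound cycle asymptotics).** Let $2<\tau<3$ and let $l$ be a nonnegative Borel measurable function on $[1,\infty)$ that is slowly varying, i.e. $l(x)>0$ for all large $x$ and $l(cx)/l(x)\to1$ as $x\to\infty$ for every $c>0$, and such that $\rho(h)=h^{-\tau}l(h)$, $h\ge1$, is a probability density. Let $k\ge4$ be even, and assume that $l^{k/2}$ is locally integrable on $[1,\infty)$ (for instance, that $l$ is locally bounded there). Let $\mu=\int_1^\infty h\rho(h)\,dh$ and $\overline F(x)=\int_x^\infty\rho(h)\,dh$ for $x\ge 1$. Consider the rank-1 inhomogeneous random graph on $n$ vertices: the vertices have i.i.d. weights $h_1,\dots,h_n$ with density $\rho$ and, given the weights, each pair $i\neq j$ is joined by an edge, independently of the other pairs, with probability $\min\left(\frac{h_ih_j}{\mu n},1\right)$. Let $C_k(n)$ and $A_k(n)$ be the expected numbers of cycles on $k$ vertices and of cliques on $k$ vertices in this graph. Then, as $n\to\infty$, $$C_k(n)\gtrsim n^k\,\overline F(\sqrt n)^k\int_{\sqrt{n\mu}}^{n\mu}\frac1h\,\frac{l^{k/2}(h)\,l^{k/2}(n\mu/h)}{l^k(\sqrt{n\mu})}\,dh,$$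 where $g_1(n)\gtrsim g_2(n)$ means that $\liminf_{n\to\infty}g_1(n)/g_2(n)\ge C$ for some constant $C>0$. Moreover $A_k(n)/C_k(n)\to0$ as $n\to\infty$: cycles of even size $k$ grow strictly faster in number than cliques of the same size. -/

import Mathlib

open MeasureTheory Filter Topology

/-- A (Borel measurable) slowly varying function: `l` is positive near infinity and
`l (c x) / l x → 1` for every fixed `c > 0`. -/
structure SlowlyVarying (l : ℝ → ℝ) : Prop where
  measurable : Measurable l
  eventually_pos : ∀ᶠ x in atTop, 0 < l x
  tendsto_div : ∀ c : ℝ, 0 < c → Tendsto (fun x => l (c * x) / l x) atTop (𝓝 1)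

/-- `AsympGE g₁ g₂` is `g₁(n) ≳ g₂(n)`: there is a constant `C > 0` with
`liminf_{n → ∞} g₁(n) / g₂(n) ≥ C`. The limit inferior is taken in the extended reals, so that it
exists (it may be `+∞`). A quotient with denominator `0` counts as `0`, so this forces
`g₁(n)` and `g₂(n)` to be nonzero for all large `n`. -/
def AsympGE (g₁ g₂ : ℕ → ℝ) : Prop :=
  ∃ C : ℝ, 0 < C ∧ (C : EReal) ≤ liminf (fun n => ((g₁ n / g₂ n : ℝ) : EReal)) atTop

namespace RankOne

/-- The weight distribution: the measure on `[1, ∞)` with density `ρ(h) = h ^ (-τ) * l h`. -/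
noncomputable def weightLaw (τ : ℝ) (l : ℝ → ℝ) : Measure ℝ :=
  (volume.restrict (Set.Ici 1)).withDensity (fun h => ENNReal.ofReal (h ^ (-τ) * l h))

/-- The average weight `μ`. -/
noncomputable def meanWeight (τ : ℝ) (l : ℝ → ℝ) : ℝ := ∫ h, h ∂(weightLaw τ l)

/-- The tail `P(H > x)` of the weight distribution. -/
noncomputable def tail (τ : ℝ) (l : ℝ → ℝ) (x : ℝ) : ℝ := (weightLaw τ l).real (Set.Ioi x)

/-- The Chung-Lu connection probability `min (h h' / (μ n)) 1`. -/
noncomputable def connProb (μ : ℝ) (n : ℕ) (h h' : ℝ) : ℝ := min (h * h' / (μ * n)) 1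

/-- The graph on the vertices `0, …, n - 1` determined by the weights `h` and by one number
`u e ∈ [0, 1]` for each unordered pair `e`: the pair is an edge when `u e` is below the connection
probability. -/
def graph (μ : ℝ) (n : ℕ) (h : Fin n → ℝ) (u : Sym2 (Fin n) → ℝ) : SimpleGraph (Fin n) where
  Adj i j := i ≠ j ∧ u s(i, j) < connProb μ n (h i) (h j)
  symm := ⟨fun i j hij => ⟨hij.1.symm, by
    have h2 := hij.2
    rw [Sym2.eq_swap, connProb, mul_comm (h j)]
    exact h2⟩⟩
  loopless := ⟨fun _ hi => hi.1 rfl⟩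

/-- The joint law of the randomness: the weights are i.i.d. with law `weightLaw τ l`, and,
independently of them, the numbers attached to the unordered pairs are i.i.d. uniform on `[0, 1]`.
So, given the weights, distinct pairs of vertices are connected independently of each other, each
with its connection probability. -/
noncomputable def randomness (τ : ℝ) (l : ℝ → ℝ) (n : ℕ) :
    Measure ((Fin n → ℝ) × (Sym2 (Fin n) → ℝ)) :=
  (Measure.pi fun _ => weightLaw τ l).prod
    (Measure.pi fun _ => volume.restrict (Set.Icc (0 : ℝ) 1))

/-- `C_k(n)`: the average number of `k`-cycles, i.e. of subgraphs that are cycles on `k` vertices,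
in the random graph on `n` vertices (for `k ≥ 3`). -/
noncomputable def avgCycles (τ : ℝ) (l : ℝ → ℝ) (k n : ℕ) : ℝ :=
  ∫ ω, ((graph (meanWeight τ l) n ω.1 ω.2).copyCount (SimpleGraph.cycleGraph k) : ℝ)
    ∂(randomness τ l n)

/-- `A_k(n)`: the average number of `k`-cliques, i.e. of sets of `k` pairwise adjacent vertices,
in the random graph on `n` vertices. -/
noncomputable def avgCliques (τ : ℝ) (l : ℝ → ℝ) (k n : ℕ) : ℝ :=
  ∫ ω, (Set.ncard {s : Finset (Fin n) | (graph (meanWeight τ l) n ω.1 ω.2).IsNClique k s} : ℝ)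
    ∂(randomness τ l n)

end RankOne

/-! Write `k = 2m`, `N = μn`, `s = √N`, `D = (s^(1-τ) l(s))^k`, and let `J` be the integral of
`l(t)^m l(N/t)^m / t` over `(s, N]`, divided by `l(s)^k`. The proof shows that `C_k(n)` is at least
a constant times `n^k D J`, while `A_k(n)` is at most a constant times `n^k D`. As the `k`-th power
of the tail at `√n` is `O(D)`, the first estimate gives the lower bound. As `J → ∞`, the two
together give `A_k(n)/C_k(n) → 0`.

Cycles: if the weights around the cycle alternate between `(t, 2t]` and `(N/t, 2N/t]`, consecutive
products exceed `N` and every edge is present almost surely. By Potter's bounds such a box has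
probability at least of order `D l(t)^m l(N/t)^m / l(s)^k`. The boxes for different `t` overlap, but
the scales `t` compatible with a given weight span a factor of only 2, so integrating over `dt/t`
costs at most a constant (`lintegral_alternating_boxes_le`). Potter's bounds fail when `N/t` is
bounded; that end of the integral is compared with a neighbouring piece through local integrability
of `l^m` (`lintegral_cycleKernel_end_le`). Finally `J` diverges because, for any fixed `A`, the
window `(s, As]` alone contributes of order `log A`.

Cliques: keep only the edges `{i, i+1}` and `{i, i+2}` modulo `k`, a union of `k` triangles. In
weights rescaled by `s`, a triangle has probability at most `g(x) g(y) g(z)`, where `g` is `x^a` up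
to 1 and `x^b` beyond, with `b < τ-1 < a` (`triangle_le_twoPower`). Multiplying over the triangles
(`prod_circulantEdges_le`) bounds the clique by a product of functions of single weights.
Independence turns its expectation into `(E g)^k`, and `E g` is `O(s^(1-τ) l(s))` since both
exponents make weights of order `s` dominate (`exists_lintegral_twoPower_le`). -/

/-! ### Slow variation: uniform convergence and Potter's bounds -/

/-- A measurable function with `f (x + u) - f x → 0` for every `u` has small increments over
`[0, 1]`, uniformly near infinity (Karamata's uniform convergence theorem, additive form). -/
theorem eventually_abs_sub_lt_of_tendsto_sub {f : ℝ → ℝ} (hf : Measurable f)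
    (h : ∀ u, Tendsto (fun x => f (x + u) - f x) atTop (𝓝 0)) {ε : ℝ} (hε : 0 < ε) :
    ∃ X : ℝ, ∀ x, X ≤ x → ∀ u ∈ Set.Icc (0 : ℝ) 1, |f (x + u) - f x| < ε := by
  -- The window `[0, 2]` contains both `v` and `v - u` for `v ∈ [1, 2]`, `u ∈ [0, 1]`. On this
  -- finite measure, pointwise convergence gives convergence in measure.
  set ν : Measure ℝ := volume.restrict (Set.Icc 0 2) with hν
  have hm : ∀ x, Measurable fun u => f (x + u) - f x := fun x => by fun_prop
  have key : Tendsto (fun x => ν {u | ENNReal.ofReal (ε / 2) ≤ edist (f (x + u) - f x) 0})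
      atTop (𝓝 0) := by
    refine tendsto_of_seq_tendsto fun x hx => ?_
    have := tendstoInMeasure_of_tendsto_ae (μ := ν) (f := fun n u => f (x n + u) - f (x n))
      (g := fun _ => (0 : ℝ)) (fun n => (hm _).aestronglyMeasurable)
      (Eventually.of_forall fun u => (h u).comp hx)
    exact this _ (by simpa using hε)
  have hlt : ∀ᶠ x in atTop, ν {u | ENNReal.ofReal (ε / 2) ≤ edist (f (x + u) - f x) 0}
      < ENNReal.ofReal (1 / 2) := key.eventually (gt_mem_nhds (by simp))
  obtain ⟨X, hX⟩ := eventually_atTop.1 hlt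
  have hset : ∀ x, {u | ENNReal.ofReal (ε / 2) ≤ edist (f (x + u) - f x) 0} =
      {u | ε / 2 ≤ |f (x + u) - f x|} := fun x => by
    ext u
    simp only [Set.mem_ofPred_eq, edist_dist, dist_zero_right, Real.norm_eq_abs]
    exact ENNReal.ofReal_le_ofReal_iff (abs_nonneg _)
  simp only [hset] at hX
  refine ⟨X, fun x hx u hu => ?_⟩
  set B₁ : Set ℝ := {v | ε / 2 ≤ |f (x + v) - f x|} with hB₁
  set B₂ : Set ℝ := {v | ε / 2 ≤ |f (x + u + v) - f (x + u)|} with hB₂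
  have hB₁m : MeasurableSet B₁ := measurableSet_le measurable_const (hm x).abs
  have hB₂m : MeasurableSet B₂ := measurableSet_le measurable_const (hm (x + u)).abs
  have h1 : volume (B₁ ∩ Set.Icc 0 2) < ENNReal.ofReal (1 / 2) := by
    rw [← Measure.restrict_apply hB₁m]; exact hX x hx
  have h2 : volume (B₂ ∩ Set.Icc 0 2) < ENNReal.ofReal (1 / 2) := by
    rw [← Measure.restrict_apply hB₂m]; exact hX (x + u) (by linarith [hu.1])
  have h3 : volume ((fun v => v - u) ⁻¹' (B₂ ∩ Set.Icc 0 2)) < ENNReal.ofReal (1 / 2) := by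
    simpa only [sub_eq_add_neg, measure_preimage_add_right] using h2
  -- Two bad sets of measure below `1/2` cannot cover an interval of length 1, so some `x + v` is
  -- close in value to both `x` and `x + u`.
  obtain ⟨v, hv, hvB⟩ : ∃ v ∈ Set.Icc (1 : ℝ) 2,
      v ∉ (B₁ ∩ Set.Icc 0 2) ∪ (fun v => v - u) ⁻¹' (B₂ ∩ Set.Icc 0 2) := by
    by_contra! hcon
    have := (measure_mono (μ := volume) (s := Set.Icc (1 : ℝ) 2) hcon).trans
      (measure_union_le _ _)
    have h4 := this.trans_lt (ENNReal.add_lt_add h1 h3)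
    rw [Real.volume_Icc, ← ENNReal.ofReal_add (by norm_num) (by norm_num)] at h4
    norm_num at h4
  simp only [Set.mem_union, not_or, Set.mem_inter_iff, Set.mem_preimage, not_and] at hvB
  have a1 : |f (x + v) - f x| < ε / 2 := by
    by_contra! hc
    exact hvB.1 hc ⟨by linarith [hv.1], hv.2⟩
  have a2 : |f (x + v) - f (x + u)| < ε / 2 := by
    by_contra! hc
    refine hvB.2 ?_ ⟨by linarith [hv.1, hu.2], by linarith [hv.2, hu.1]⟩
    simpa [hB₂] using hc
  rw [abs_lt] at *
  constructor <;> linarith [a1.1, a1.2, a2.1, a2.2]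

/-- Telescoping over unit steps: each costs less than `ε`, and the `+ 1` pays for the last
incomplete step. -/
theorem abs_sub_le_mul_add_one_of_tendsto_sub {f : ℝ → ℝ} (hf : Measurable f)
    (h : ∀ u, Tendsto (fun x => f (x + u) - f x) atTop (𝓝 0)) {ε : ℝ} (hε : 0 < ε) :
    ∃ X : ℝ, ∀ x, X ≤ x → ∀ y, x ≤ y → |f y - f x| ≤ ε * (y - x + 1) := by
  obtain ⟨X, hX⟩ := eventually_abs_sub_lt_of_tendsto_sub hf h hε
  refine ⟨X, ?_⟩
  have key : ∀ n : ℕ, ∀ x, X ≤ x → ∀ y, x ≤ y → y - x ≤ n → |f y - f x| ≤ ε * (y - x + 1) := by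
    intro n
    induction n with
    | zero =>
      intro x hx y hy hn
      have : y = x := by push_cast at hn; linarith
      subst this
      simpa using hε.le
    | succ n ih =>
      intro x hx y hy hn
      by_cases h1 : y - x ≤ 1
      · have := hX x hx (y - x) ⟨by linarith, h1⟩
        rw [add_sub_cancel] at this
        nlinarith
      · push Not at h1
        have e1 := hX x hx 1 ⟨by norm_num, le_rfl⟩
        have e2 := ih (x + 1) (by linarith) y (by linarith) (by push_cast at hn; linarith)
        have := abs_add_le (f y - f (x + 1)) (f (x + 1) - f x)
        rw [sub_add_sub_cancel] at this
        nlinarith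
  intro x hx y hy
  obtain ⟨n, hn⟩ := exists_nat_ge (y - x)
  exact key n x hx y hy hn

/-- The two-sided Potter bound with exponent `ε` beyond `M`. -/
def PotterBound (l : ℝ → ℝ) (ε M : ℝ) : Prop :=
  1 ≤ M ∧ ∀ x, M ≤ x → 0 < l x ∧ ∀ y, x ≤ y →
    l y ≤ Real.exp ε * (y / x) ^ ε * l x ∧ l x ≤ Real.exp ε * (y / x) ^ ε * l y

/-- Potter's bounds for slowly varying functions. -/
theorem SlowlyVarying.potter {l : ℝ → ℝ} (hl : SlowlyVarying l) {ε : ℝ} (hε : 0 < ε) :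
    ∃ M : ℝ, PotterBound l ε M := by
  -- In the additive variable, slow variation says that `log ∘ l ∘ exp` has vanishing increments;
  -- exponentiating the linear bound gives Potter's bounds.
  have hf : Measurable fun x => Real.log (l (Real.exp x)) :=
    Real.measurable_log.comp (hl.measurable.comp Real.measurable_exp)
  have hlim : ∀ u, Tendsto (fun x => Real.log (l (Real.exp (x + u))) - Real.log (l (Real.exp x)))
      atTop (𝓝 0) := by
    intro u
    have h1 := ((Real.continuousAt_log one_ne_zero).tendsto.comp
      (hl.tendsto_div (Real.exp u) (Real.exp_pos u))).comp Real.tendsto_exp_atTop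
    rw [Real.log_one] at h1
    refine h1.congr' ?_
    have p1 := Real.tendsto_exp_atTop.eventually hl.eventually_pos
    have p2 := (Real.tendsto_exp_atTop.comp (tendsto_atTop_add_const_right atTop u
      tendsto_id)).eventually hl.eventually_pos
    filter_upwards [p1, p2] with x hx1 hx2
    simp only [Function.comp_apply, id] at hx2 ⊢
    rw [← Real.exp_add, add_comm u x, Real.log_div hx2.ne' hx1.ne']
  obtain ⟨X, hX⟩ := abs_sub_le_mul_add_one_of_tendsto_sub hf hlim hε
  obtain ⟨Y, hY⟩ := eventually_atTop.1 hl.eventually_pos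
  refine ⟨max 1 (max (Real.exp X) Y), le_max_left _ _, fun x hx => ?_⟩
  simp only [max_le_iff] at hx
  obtain ⟨hx1, hx2, hx3⟩ := hx
  refine ⟨hY x hx3, fun y hy => ?_⟩
  have x0 : 0 < x := by linarith
  have y0 : 0 < y := by linarith
  have lx := hY x hx3
  have ly := hY y (hx3.trans hy)
  have := hX (Real.log x) ((Real.le_log_iff_exp_le x0).2 hx2) (Real.log y)
    (Real.log_le_log x0 hy)
  rw [Real.exp_log x0, Real.exp_log y0, abs_le] at this
  have hE : Real.exp ε * (y / x) ^ ε = Real.exp (ε * (Real.log y - Real.log x + 1)) := by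
    rw [Real.rpow_def_of_pos (by positivity), Real.log_div y0.ne' x0.ne', ← Real.exp_add]
    congr 1; ring
  rw [hE]
  constructor
  · rw [← Real.log_le_log_iff ly (by positivity), Real.log_mul (by positivity) lx.ne',
      Real.log_exp]
    linarith [this.2]
  · rw [← Real.log_le_log_iff lx (by positivity), Real.log_mul (by positivity) ly.ne',
      Real.log_exp]
    linarith [this.1]

/-! ### Truncated moments, tail and mean of the weight law -/

/-- The function equal to `x ^ a` on `[0, 1]` and to `x ^ b` beyond. -/
noncomputable def twoPower (a b x : ℝ) : ℝ := if x ≤ 1 then x ^ a else x ^ b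

theorem measurable_twoPower (a b : ℝ) : Measurable (twoPower a b) :=
  Measurable.ite measurableSet_Iic (by fun_prop) (by fun_prop)

theorem twoPower_nonneg {a b x : ℝ} (hx : 0 ≤ x) : 0 ≤ twoPower a b x := by
  unfold twoPower; split_ifs <;> positivity

theorem lintegral_Ioi_rpow {p s : ℝ} (hp : p < -1) (hs : 0 < s) :
    ∫⁻ h in Set.Ioi s, ENNReal.ofReal (h ^ p) = ENNReal.ofReal (s ^ (p + 1) / (-(p + 1))) := by
  rw [← ofReal_integral_eq_lintegral_ofReal (integrableOn_Ioi_rpow_of_lt hp hs),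
    integral_Ioi_rpow_of_lt hp hs]
  · congr 1; rw [div_neg, neg_div]
  · filter_upwards [ae_restrict_mem measurableSet_Ioi] with h hh
    exact Real.rpow_nonneg (hs.le.trans (le_of_lt hh)) _

theorem lintegral_Ioc_zero_rpow {p s : ℝ} (hp : -1 < p) (hs : 0 < s) :
    ∫⁻ h in Set.Ioc 0 s, ENNReal.ofReal (h ^ p) = ENNReal.ofReal (s ^ (p + 1) / (p + 1)) := by
  have h1 := (intervalIntegral.intervalIntegrable_rpow' (a := 0) (b := s) hp)
  rw [intervalIntegrable_iff_integrableOn_Ioc_of_le hs.le] at h1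
  rw [← ofReal_integral_eq_lintegral_ofReal h1, ← intervalIntegral.integral_of_le hs.le,
    integral_rpow (Or.inl hp), Real.zero_rpow (by linarith), sub_zero]
  filter_upwards [ae_restrict_mem measurableSet_Ioc] with h hh
  exact Real.rpow_nonneg hh.1.le _

namespace RankOne

variable {τ : ℝ} {l : ℝ → ℝ} {ε M : ℝ}

theorem setLIntegral_weightLaw (hl : Measurable l) {F : ℝ → ENNReal} (hF : Measurable F)
    {s : Set ℝ} (hs : MeasurableSet s) (hs1 : s ⊆ Set.Ici 1) :
    ∫⁻ h in s, F h ∂(weightLaw τ l) = ∫⁻ h in s, ENNReal.ofReal (h ^ (-τ) * l h) * F h := by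
  have hm : Measurable fun h : ℝ => ENNReal.ofReal (h ^ (-τ) * l h) := by fun_prop
  rw [weightLaw, restrict_withDensity hs, lintegral_withDensity_eq_lintegral_mul _ hm hF,
    Measure.restrict_restrict hs, Set.inter_eq_left.2 hs1]
  rfl

theorem ae_one_le_weightLaw : ∀ᵐ h ∂(weightLaw τ l), 1 ≤ h :=
  (withDensity_absolutelyContinuous _ _).ae_le (ae_restrict_mem measurableSet_Ici)

/-- Potter's bound replaces `l h` by `(h/s)^ε l s`, leaving a pure power whose exponent `b + ε - τ`
is below `-1`. -/
theorem setLIntegral_Ioi_weightLaw_le (hl : Measurable l) (hP : PotterBound l ε M) {b : ℝ}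
    (hb : b + ε < τ - 1) {s : ℝ} (hs : M ≤ s) :
    ∫⁻ h in Set.Ioi s, ENNReal.ofReal ((h / s) ^ b) ∂(weightLaw τ l) ≤
      ENNReal.ofReal (Real.exp ε / (τ - 1 - b - ε) * (s ^ (1 - τ) * l s)) := by
  have s1 : 1 ≤ s := hP.1.trans hs
  have s0 : 0 < s := by linarith
  have ls := (hP.2 s hs).1
  rw [setLIntegral_weightLaw hl (by fun_prop) measurableSet_Ioi
    (fun h hh => s1.trans (le_of_lt hh))]
  calc ∫⁻ h in Set.Ioi s, ENNReal.ofReal (h ^ (-τ) * l h) * ENNReal.ofReal ((h / s) ^ b)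
      ≤ ∫⁻ h in Set.Ioi s, ENNReal.ofReal (Real.exp ε * l s * s ^ (-b - ε)) *
          ENNReal.ofReal (h ^ (b + ε - τ)) := by
        refine setLIntegral_mono (by fun_prop) fun h hh => ?_
        have h0 : 0 < h := s0.trans hh
        have lh := (hP.2 h (hs.trans (le_of_lt hh))).1
        rw [← ENNReal.ofReal_mul (by positivity), ← ENNReal.ofReal_mul (by positivity)]
        refine ENNReal.ofReal_le_ofReal ?_
        calc h ^ (-τ) * l h * (h / s) ^ b
            ≤ h ^ (-τ) * (Real.exp ε * (h / s) ^ ε * l s) * (h / s) ^ b := by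
              gcongr; exact ((hP.2 s hs).2 h (le_of_lt hh)).1
          _ = _ := by
              rw [Real.div_rpow h0.le s0.le, Real.div_rpow h0.le s0.le, Real.rpow_sub h0,
                Real.rpow_add h0, Real.rpow_sub s0, Real.rpow_neg s0.le, Real.rpow_neg h0.le]
              field_simp
    _ = _ := by
        rw [lintegral_const_mul _ (by fun_prop), lintegral_Ioi_rpow (by linarith) s0,
          ← ENNReal.ofReal_mul (by positivity)]
        congr 1
        have : s ^ (1 - τ) = s ^ (-b - ε) * s ^ (b + ε - τ + 1) := by
          rw [← Real.rpow_add s0]; congr 1; ring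
        rw [this]
        have h3 : τ - 1 - b - ε ≠ 0 := by linarith
        have h4 : -(b + ε - τ + 1) = τ - 1 - b - ε := by ring
        rw [h4]
        field_simp

/-- The mirror estimate below `s`: the remaining exponent `a - ε - τ` exceeds `-1`, so the power may
be integrated down to 0. Starting at `M` keeps Potter's bounds available. -/
theorem setLIntegral_Icc_weightLaw_le (hl : Measurable l) (hP : PotterBound l ε M) {a : ℝ}
    (ha : τ - 1 < a - ε) {s : ℝ} (hs : M ≤ s) :
    ∫⁻ h in Set.Icc M s, ENNReal.ofReal ((h / s) ^ a) ∂(weightLaw τ l) ≤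
      ENNReal.ofReal (Real.exp ε / (a - ε - τ + 1) * (s ^ (1 - τ) * l s)) := by
  have s1 : 1 ≤ s := hP.1.trans hs
  have s0 : 0 < s := by linarith
  have ls := (hP.2 s hs).1
  rw [setLIntegral_weightLaw hl (by fun_prop) measurableSet_Icc
    (fun h hh => hP.1.trans hh.1)]
  calc ∫⁻ h in Set.Icc M s, ENNReal.ofReal (h ^ (-τ) * l h) * ENNReal.ofReal ((h / s) ^ a)
      ≤ ∫⁻ h in Set.Icc M s, ENNReal.ofReal (Real.exp ε * l s * s ^ (ε - a)) *
          ENNReal.ofReal (h ^ (a - ε - τ)) := by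
        refine setLIntegral_mono (by fun_prop) fun h hh => ?_
        have h0 : 0 < h := by linarith [hP.1, hh.1]
        have lh := (hP.2 h hh.1).1
        rw [← ENNReal.ofReal_mul (by positivity), ← ENNReal.ofReal_mul (by positivity)]
        refine ENNReal.ofReal_le_ofReal ?_
        calc h ^ (-τ) * l h * (h / s) ^ a
            ≤ h ^ (-τ) * (Real.exp ε * (s / h) ^ ε * l s) * (h / s) ^ a := by
              gcongr; exact ((hP.2 h hh.1).2 s hh.2).2
          _ = _ := by
              rw [Real.div_rpow h0.le s0.le, Real.div_rpow s0.le h0.le, Real.rpow_sub h0,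
                Real.rpow_sub h0, Real.rpow_sub s0, Real.rpow_neg h0.le]
              field_simp
    _ ≤ ∫⁻ h in Set.Ioc 0 s, ENNReal.ofReal (Real.exp ε * l s * s ^ (ε - a)) *
          ENNReal.ofReal (h ^ (a - ε - τ)) :=
        lintegral_mono_set fun h hh => ⟨by linarith [hP.1, hh.1], hh.2⟩
    _ = _ := by
        rw [lintegral_const_mul _ (by fun_prop), lintegral_Ioc_zero_rpow (by linarith) s0,
          ← ENNReal.ofReal_mul (by positivity)]
        congr 1
        have : s ^ (1 - τ) = s ^ (ε - a) * s ^ (a - ε - τ + 1) := by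
          rw [← Real.rpow_add s0]; congr 1; ring
        rw [this]
        have h3 : a - ε - τ + 1 ≠ 0 := by linarith
        field_simp

/-- The exponent `a` is too large for small weights to matter and `b` too small for large ones, so
the expectation has the order of the tail at `s`. Weights below `M` contribute at most `(M/s)^a`,
which is also of lower order because `a > τ - 1 + ε`. -/
theorem exists_lintegral_twoPower_le [IsProbabilityMeasure (weightLaw τ l)] (hl : Measurable l)
    (hP : PotterBound l ε M) {a b : ℝ} (ha0 : 0 ≤ a) (hε : 0 ≤ ε)
    (ha : τ - 1 < a - ε) (hb : b + ε < τ - 1) :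
    ∃ C : ℝ, 0 < C ∧ ∀ s, M ≤ s →
      ∫⁻ h, ENNReal.ofReal (twoPower a b (|h| / s)) ∂(weightLaw τ l) ≤
        ENNReal.ofReal (C * (s ^ (1 - τ) * l s)) := by
  have M0 : 0 < M := by linarith [hP.1]
  have lM := (hP.2 M le_rfl).1
  have hd1 : 0 < a - ε - τ + 1 := by linarith
  have hd2 : 0 < τ - 1 - b - ε := by linarith
  refine ⟨M ^ a * Real.exp ε / l M + Real.exp ε / (a - ε - τ + 1) + Real.exp ε / (τ - 1 - b - ε),
    by positivity, fun s hs => ?_⟩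
  have s1 : 1 ≤ s := hP.1.trans hs
  have s0 : 0 < s := by linarith
  have ls := (hP.2 s hs).1
  set F : ℝ → ENNReal := fun h => ENNReal.ofReal (twoPower a b (|h| / s)) with hF
  have hcov : (Set.univ : Set ℝ) ⊆ Set.Iic M ∪ Set.Icc M s ∪ Set.Ioi s := by
    intro x _
    simp only [Set.mem_union, Set.mem_Iic, Set.mem_Icc, Set.mem_Ioi]
    by_cases h1 : x ≤ M
    · exact Or.inl (Or.inl h1)
    · by_cases h2 : x ≤ s
      · exact Or.inl (Or.inr ⟨by linarith, h2⟩)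
      · exact Or.inr (by linarith)
  have hae := (ae_one_le_weightLaw (τ := τ) (l := l))
  have e1 : ∫⁻ h in Set.Iic M, F h ∂(weightLaw τ l) ≤
      ENNReal.ofReal (M ^ a * Real.exp ε / l M * (s ^ (1 - τ) * l s)) := by
    calc ∫⁻ h in Set.Iic M, F h ∂(weightLaw τ l)
        ≤ ∫⁻ h in Set.Iic M, ENNReal.ofReal ((M / s) ^ a) ∂(weightLaw τ l) := by
          refine lintegral_mono_ae ?_
          filter_upwards [ae_restrict_mem measurableSet_Iic, ae_restrict_of_ae hae] with h h1 h2
          refine ENNReal.ofReal_le_ofReal ?_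
          have h1' : h ≤ M := h1
          rw [abs_of_nonneg (by linarith), twoPower, if_pos ((div_le_one s0).2 (by linarith))]
          gcongr
      _ ≤ ENNReal.ofReal ((M / s) ^ a) := by
          rw [setLIntegral_const]
          exact mul_le_of_le_one_right zero_le prob_le_one
      _ ≤ _ := by
          refine ENNReal.ofReal_le_ofReal ?_
          have p1 := ((hP.2 M le_rfl).2 s hs).2
          have p2 : l M ≤ Real.exp ε * s ^ ε * l s := p1.trans (by
            gcongr; exact div_le_self s0.le hP.1)
          have p3 : s ^ (-a) ≤ s ^ (1 - τ - ε) :=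
            Real.rpow_le_rpow_of_exponent_le s1 (by linarith)
          calc (M / s) ^ a = M ^ a / l M * (s ^ (-a) * l M) := by
                rw [Real.div_rpow M0.le s0.le, Real.rpow_neg s0.le]; field_simp
            _ ≤ M ^ a / l M * (s ^ (1 - τ - ε) * (Real.exp ε * s ^ ε * l s)) := by gcongr
            _ = _ := by
                rw [Real.rpow_sub s0]; field_simp
  have e2 : ∫⁻ h in Set.Icc M s, F h ∂(weightLaw τ l) ≤
      ENNReal.ofReal (Real.exp ε / (a - ε - τ + 1) * (s ^ (1 - τ) * l s)) := by
    refine le_trans (le_of_eq ?_) (setLIntegral_Icc_weightLaw_le hl hP ha hs)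
    refine setLIntegral_congr_fun measurableSet_Icc fun h hh => ?_
    simp only [hF]
    rw [abs_of_nonneg (by linarith [hh.1]), twoPower, if_pos ((div_le_one s0).2 hh.2)]
  have e3 : ∫⁻ h in Set.Ioi s, F h ∂(weightLaw τ l) ≤
      ENNReal.ofReal (Real.exp ε / (τ - 1 - b - ε) * (s ^ (1 - τ) * l s)) := by
    refine le_trans (le_of_eq ?_) (setLIntegral_Ioi_weightLaw_le hl hP hb hs)
    refine setLIntegral_congr_fun measurableSet_Ioi fun h hh => ?_
    simp only [hF]
    rw [abs_of_nonneg (s0.le.trans (le_of_lt hh)), twoPower,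
      if_neg (by rw [div_le_one s0, not_le]; exact hh)]
  calc ∫⁻ h, F h ∂(weightLaw τ l)
      = ∫⁻ h in Set.univ, F h ∂(weightLaw τ l) := by rw [Measure.restrict_univ]
    _ ≤ ∫⁻ h in Set.Iic M ∪ Set.Icc M s ∪ Set.Ioi s, F h ∂(weightLaw τ l) :=
        lintegral_mono_set hcov
    _ ≤ ∫⁻ h in Set.Iic M, F h ∂(weightLaw τ l) + ∫⁻ h in Set.Icc M s, F h ∂(weightLaw τ l) +
          ∫⁻ h in Set.Ioi s, F h ∂(weightLaw τ l) :=
        (lintegral_union_le _ _ _).trans (add_le_add_left (lintegral_union_le _ _ _) _)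
    _ ≤ _ := by
        rw [add_mul, add_mul, ENNReal.ofReal_add (by positivity) (by positivity),
          ENNReal.ofReal_add (by positivity) (by positivity)]
        gcongr

/-- On a dyadic block `l` stays within the factor `exp ε * 2 ^ ε` of `l y`, and `h ^ (-τ)` is
smallest at the right end. -/
theorem le_weightLaw_Ioc (hl : Measurable l) (hP : PotterBound l ε M) (hε : 0 ≤ ε) (hτ : 0 ≤ τ)
    {y : ℝ} (hy : M ≤ y) :
    ENNReal.ofReal (2 ^ (-τ) * (Real.exp ε * 2 ^ ε)⁻¹ * (y ^ (1 - τ) * l y)) ≤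
      weightLaw τ l (Set.Ioc y (2 * y)) := by
  have y1 : 1 ≤ y := hP.1.trans hy
  have y0 : 0 < y := by linarith
  have ly := (hP.2 y hy).1
  rw [← setLIntegral_one, setLIntegral_weightLaw hl measurable_const measurableSet_Ioc
    (fun h hh => y1.trans hh.1.le)]
  calc ENNReal.ofReal (2 ^ (-τ) * (Real.exp ε * 2 ^ ε)⁻¹ * (y ^ (1 - τ) * l y))
      = ∫⁻ h in Set.Ioc y (2 * y),
          ENNReal.ofReal ((2 * y) ^ (-τ) * ((Real.exp ε * 2 ^ ε)⁻¹ * l y)) := by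
        rw [setLIntegral_const, Real.volume_Ioc, ← ENNReal.ofReal_mul (by positivity)]
        congr 1
        rw [Real.mul_rpow (by norm_num) y0.le, Real.rpow_sub y0, Real.rpow_neg y0.le,
          Real.rpow_one]
        ring
    _ ≤ _ := by
        refine setLIntegral_mono (by fun_prop) fun h hh => ?_
        rw [mul_one]
        have h0 : 0 < h := y0.trans hh.1
        have lh := (hP.2 h (hy.trans hh.1.le)).1
        refine ENNReal.ofReal_le_ofReal (mul_le_mul ?_ ?_ (by positivity) (by positivity))
        · exact Real.rpow_le_rpow_of_nonpos h0 hh.2 (by linarith)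
        · rw [inv_mul_le_iff₀ (by positivity)]
          refine ((hP.2 y hy).2 h hh.1.le).2.trans ?_
          gcongr
          rw [div_le_iff₀ y0]; exact hh.2

theorem tail_le [IsProbabilityMeasure (weightLaw τ l)] (hl : Measurable l)
    (hP : PotterBound l ε M) (hτ : ε < τ - 1) {s : ℝ} (hs : M ≤ s) :
    tail τ l s ≤ Real.exp ε / (τ - 1 - ε) * (s ^ (1 - τ) * l s) := by
  have h := setLIntegral_Ioi_weightLaw_le hl hP (b := 0) (τ := τ) (by linarith) hs
  simp only [Real.rpow_zero, ENNReal.ofReal_one, setLIntegral_one, sub_zero] at h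
  have s0 : 0 < s := by linarith [hP.1]
  have ls := (hP.2 s hs).1
  exact ENNReal.toReal_le_of_le_ofReal
    (mul_nonneg (div_nonneg (Real.exp_pos _).le (by linarith)) (by positivity)) h

theorem tail_pos [IsProbabilityMeasure (weightLaw τ l)] (hl : Measurable l)
    (hP : PotterBound l ε M) (hε : 0 ≤ ε) (hτ : 0 ≤ τ) {s : ℝ} (hs : M ≤ s) :
    0 < tail τ l s := by
  have s0 : 0 < s := by linarith [hP.1]
  have ls := (hP.2 s hs).1
  have h := (le_weightLaw_Ioc hl hP hε hτ hs).trans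
    (measure_mono (fun x hx => hx.1 : Set.Ioc s (2 * s) ⊆ Set.Ioi s))
  refine ENNReal.toReal_pos (ne_of_gt (lt_of_lt_of_le ?_ h)) (measure_ne_top _ _)
  rw [ENNReal.ofReal_pos]; positivity

theorem integrable_id_weightLaw [IsProbabilityMeasure (weightLaw τ l)] (hl : Measurable l)
    (hP : PotterBound l ε M) (hτ : 1 + ε < τ - 1) : Integrable (fun h => h) (weightLaw τ l) := by
  have M0 : 0 < M := by linarith [hP.1]
  rw [← integrableOn_univ, ← Set.Iic_union_Ioi (a := M)]
  refine IntegrableOn.union ?_ ?_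
  · refine Measure.integrableOn_of_bounded (M := M) (measure_ne_top _ _)
      (by fun_prop) ?_
    filter_upwards [ae_restrict_mem measurableSet_Iic,
      ae_restrict_of_ae (ae_one_le_weightLaw (τ := τ) (l := l))] with h h1 h2
    rw [Real.norm_eq_abs, abs_of_nonneg (by linarith)]; exact h1
  · have h := setLIntegral_Ioi_weightLaw_le hl hP (b := 1) (τ := τ) hτ le_rfl
    have h2 : IntegrableOn (fun h => h / M) (Set.Ioi M) (weightLaw τ l) := by
      refine ⟨by fun_prop, ?_⟩
      rw [hasFiniteIntegral_iff_ofReal]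
      · simp only [Real.rpow_one] at h
        exact h.trans_lt ENNReal.ofReal_lt_top
      · filter_upwards [ae_restrict_mem measurableSet_Ioi] with h hh
        exact div_nonneg (M0.le.trans (le_of_lt hh)) M0.le
    have h3 := h2.mul_const M
    simpa [M0.ne', IntegrableOn] using h3

theorem one_le_meanWeight [IsProbabilityMeasure (weightLaw τ l)] (hl : Measurable l)
    (hP : PotterBound l ε M) (hτ : 1 + ε < τ - 1) : 1 ≤ meanWeight τ l := by
  have := integral_mono_ae (μ := weightLaw τ l) (integrable_const (1 : ℝ))
    (integrable_id_weightLaw hl hP hτ) ae_one_le_weightLaw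
  simpa [meanWeight] using this

end RankOne

/-! ### A product majorant for one triangle -/

theorem min_one_le_rpow {w c : ℝ} (hw : 0 ≤ w) (hc0 : 0 ≤ c) (hc1 : c ≤ 1) :
    min w 1 ≤ w ^ c := by
  rcases le_total w 1 with h | h
  · rcases hw.eq_or_lt with rfl | hw
    · simpa using Real.rpow_nonneg le_rfl c
    · rw [min_eq_left h]
      simpa using Real.rpow_le_rpow_of_exponent_ge hw h hc1
  · rw [min_eq_right h]
    exact Real.one_le_rpow h hc0

/-- Interpolation `min w 1 ≤ w ^ c`, with `c` chosen by how many variables exceed 1. With none, take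
`c = 1` throughout. If only `z` is large, take `c = 1` on `xy` and `c = a - 1` on the two edges at
`z`, giving `x^a y^a z^(2a-2)`. If only `x` is small, drop `yz` and take `c = a/2` on the edges at
`x`. With all large, the left side is at most 1. -/
theorem triangle_le_twoPower_of_le {a b x y z : ℝ} (ha1 : 1 ≤ a) (ha2 : a ≤ 2) (hab : a ≤ 2 * b)
    (hab' : 2 * a - 2 ≤ b) (hx : 0 ≤ x) (hxy : x ≤ y) (hyz : y ≤ z) :
    min (x * y) 1 * min (y * z) 1 * min (x * z) 1 ≤
      twoPower a b x * twoPower a b y * twoPower a b z := by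
  have hy : 0 ≤ y := hx.trans hxy
  have hz : 0 ≤ z := hy.trans hyz
  have m1 : 0 ≤ min (x * y) 1 := by positivity
  have m2 : 0 ≤ min (y * z) 1 := by positivity
  have m3 : 0 ≤ min (x * z) 1 := by positivity
  have sq : ∀ t : ℝ, 0 ≤ t → t ≤ 1 → t ^ 2 ≤ t ^ a := fun t ht ht1 => by
    rcases ht.eq_or_lt with rfl | ht
    · rw [zero_pow two_ne_zero]; exact Real.rpow_nonneg le_rfl a
    · rw [← Real.rpow_two]; exact Real.rpow_le_rpow_of_exponent_ge ht ht1 ha2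
  have big : ∀ t c : ℝ, 1 ≤ t → c ≤ b → t ^ c ≤ t ^ b := fun t c ht hc =>
    Real.rpow_le_rpow_of_exponent_le ht hc
  unfold twoPower
  by_cases hz1 : z ≤ 1
  · rw [if_pos (hxy.trans (hyz.trans hz1)), if_pos (hyz.trans hz1), if_pos hz1]
    calc _ ≤ (x * y) * (y * z) * (x * z) := by
          gcongr <;> exact min_le_left _ _
      _ = x ^ 2 * y ^ 2 * z ^ 2 := by ring
      _ ≤ _ := by
          gcongr
          · exact sq x hx (by linarith)
          · exact sq y hy (by linarith)
          · exact sq z hz hz1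
  · rw [if_neg hz1]
    push Not at hz1
    by_cases hy1 : y ≤ 1
    · rw [if_pos (hxy.trans hy1), if_pos hy1]
      have e : ∀ t : ℝ, 0 ≤ t → t * t ^ (a - 1) = t ^ a := fun t ht => by
        rcases ht.eq_or_lt with rfl | ht
        · rw [zero_mul, Real.zero_rpow (by linarith)]
        · rw [Real.rpow_sub ht, Real.rpow_one]; field_simp
      calc _ ≤ (x * y) * (y * z) ^ (a - 1) * (x * z) ^ (a - 1) := by
            gcongr
            · exact min_le_left _ _
            · exact min_one_le_rpow (by positivity) (by linarith) (by linarith)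
            · exact min_one_le_rpow (by positivity) (by linarith) (by linarith)
        _ = (x * x ^ (a - 1)) * (y * y ^ (a - 1)) * (z ^ (a - 1) * z ^ (a - 1)) := by
            rw [Real.mul_rpow hy hz, Real.mul_rpow hx hz]; ring
        _ = x ^ a * y ^ a * z ^ (2 * a - 2) := by
            rw [e x hx, e y hy, ← Real.rpow_add (by linarith)]
            congr 2; ring
        _ ≤ _ := mul_le_mul_of_nonneg_left (big z _ hz1.le hab') (by positivity)
    · rw [if_neg hy1]
      push Not at hy1
      by_cases hx1 : x ≤ 1
      · rw [if_pos hx1]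
        calc _ ≤ (x * y) ^ (a / 2) * 1 * (x * z) ^ (a / 2) := by
              gcongr
              · exact min_one_le_rpow (by positivity) (by linarith) (by linarith)
              · exact min_le_right _ _
              · exact min_one_le_rpow (by positivity) (by linarith) (by linarith)
          _ = (x ^ (a / 2) * x ^ (a / 2)) * y ^ (a / 2) * z ^ (a / 2) := by
              rw [Real.mul_rpow hx hy, Real.mul_rpow hx hz]; ring
          _ = x ^ a * y ^ (a / 2) * z ^ (a / 2) := by
              congr 2
              rw [← Real.rpow_add_of_nonneg hx (by linarith) (by linarith)]
              congr 1; ring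
          _ ≤ _ := mul_le_mul (mul_le_mul_of_nonneg_left (big y _ hy1.le (by linarith))
              (by positivity)) (big z _ hz1.le (by linarith)) (by positivity) (by positivity)
      · rw [if_neg hx1]
        push Not at hx1
        have hb : 0 ≤ b := by linarith
        calc _ ≤ (1 : ℝ) * 1 * 1 := by gcongr <;> exact min_le_right _ _
          _ ≤ _ := by
            gcongr
            · exact Real.one_le_rpow hx1.le hb
            · exact Real.one_le_rpow hy1.le hb
            · exact Real.one_le_rpow hz1.le hb

theorem triangle_le_twoPower {a b x y z : ℝ} (ha1 : 1 ≤ a) (ha2 : a ≤ 2) (hab : a ≤ 2 * b)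
    (hab' : 2 * a - 2 ≤ b) (hx : 0 ≤ x) (hy : 0 ≤ y) (hz : 0 ≤ z) :
    min (x * y) 1 * min (y * z) 1 * min (x * z) 1 ≤
      twoPower a b x * twoPower a b y * twoPower a b z := by
  have key := fun (x y z : ℝ) => triangle_le_twoPower_of_le (a := a) (b := b) (x := x) (y := y)
    (z := z) ha1 ha2 hab hab'
  rcases le_total x y with h1 | h1 <;> rcases le_total y z with h2 | h2 <;>
    rcases le_total x z with h3 | h3
  · exact key x y z hx h1 h2
  · exact key x y z hx h1 h2
  · calc _ = _ := by rw [mul_comm y z]; ring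
      _ ≤ _ := key x z y hx h3 h2
      _ = _ := by ring
  · calc _ = _ := by rw [mul_comm x z, mul_comm y z]; ring
      _ ≤ _ := key z x y hz h3 h1
      _ = _ := by ring
  · calc _ = _ := by rw [mul_comm x y]; ring
      _ ≤ _ := key y x z hy h1 h3
      _ = _ := by ring
  · calc _ = _ := by rw [mul_comm x y, mul_comm x z]; ring
      _ ≤ _ := key y z x hy h2 h3
      _ = _ := by ring
  · calc _ = _ := by rw [mul_comm x y, mul_comm x z, mul_comm y z]; ring
      _ ≤ _ := key z y x hz h2 h1
      _ = _ := by ring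
  · calc _ = _ := by rw [mul_comm x y, mul_comm x z, mul_comm y z]; ring
      _ ≤ _ := key z y x hz h2 h1
      _ = _ := by ring

/-! ### Decomposing a circulant graph into triangles -/

/-- The edges `{i, i + c}` of the circulant graph on `Fin k`. -/
def circulantEdges (k : ℕ) [NeZero k] (c : Fin k) : Finset (Sym2 (Fin k)) :=
  Finset.univ.image fun i => s(i, i + c)

/-- An edge arises at most once from each endpoint. Multiplicity 2 does occur: for `k = 4` the
step-2 edges `{i, i + 2}` and `{i + 2, i + 4}` coincide. -/
theorem card_filter_circulant_le (k : ℕ) [NeZero k] (c : Fin k) (e : Sym2 (Fin k)) :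
    (Finset.univ.filter fun i : Fin k => s(i, i + c) = e).card ≤ 2 := by
  induction e using Sym2.ind with
  | _ x y =>
  refine (Finset.card_le_card (t := {x, y}) fun i hi => ?_).trans Finset.card_le_two
  simp only [Finset.mem_filter, Sym2.eq_iff] at hi
  simp only [Finset.mem_insert, Finset.mem_singleton]
  tauto

theorem fin_val_one_add_one {k : ℕ} [NeZero k] (hk : 3 ≤ k) : ((1 + 1 : Fin k) : ℕ) = 2 := by
  obtain ⟨k, rfl⟩ := Nat.exists_eq_add_of_le hk
  rw [Fin.val_add, Fin.val_one', Nat.mod_eq_of_lt (by omega : 1 < 3 + k),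
    Nat.mod_eq_of_lt (by omega)]

theorem one_add_one_ne_zero_fin {k : ℕ} [NeZero k] (hk : 3 ≤ k) : (1 + 1 : Fin k) ≠ 0 := by
  intro h
  have := fin_val_one_add_one hk
  rw [h] at this
  simp at this

theorem circulant_one_injective {k : ℕ} [NeZero k] (hk : 3 ≤ k) :
    Function.Injective fun i : Fin k => s(i, i + 1) := by
  intro i j hij
  rcases Sym2.eq_iff.1 hij with ⟨h, -⟩ | ⟨h1, h2⟩
  · exact h
  · exfalso
    rw [h1, add_assoc] at h2
    exact one_add_one_ne_zero_fin hk (by simpa using h2)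

/-- A common edge would force `1 = 2` or `1 + 2 = 0` modulo `k`; the latter happens for `k = 3`. -/
theorem disjoint_circulantEdges {k : ℕ} [NeZero k] (hk : 4 ≤ k) :
    Disjoint (circulantEdges k 1) (circulantEdges k (1 + 1)) := by
  rw [Finset.disjoint_left]
  intro e h1 h2
  simp only [circulantEdges, Finset.mem_image, Finset.mem_univ, true_and] at h1 h2
  obtain ⟨i, rfl⟩ := h1
  obtain ⟨j, hj⟩ := h2
  have h11 := fin_val_one_add_one (k := k) (by omega)
  have h1v : ((1 : Fin k) : ℕ) = 1 := by
    rw [Fin.val_one', Nat.mod_eq_of_lt (by omega)]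
  rcases Sym2.eq_iff.1 hj with ⟨rfl, h⟩ | ⟨rfl, h⟩
  · have : (1 + 1 : Fin k) = 1 := by simpa using h
    rw [this, h1v] at h11; omega
  · have h3 : (1 + (1 + 1) : Fin k) = 0 := by simpa [add_assoc] using h
    have h4 : ((1 + (1 + 1) : Fin k) : ℕ) = 3 := by
      rw [Fin.val_add, h11, h1v, Nat.mod_eq_of_lt (by omega)]
    rw [h3] at h4; simp at h4

/-- If `p e ∈ [0, 1]` for all edges and every triangle satisfies `p p p ≤ g g g`, then the product
of `p` over the circulant graph with steps `1, 2` is at most the product of `g`. -/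
theorem prod_circulantEdges_le {k : ℕ} [NeZero k] (hk : 4 ≤ k) {p : Sym2 (Fin k) → ℝ}
    {g : Fin k → ℝ} (hp0 : ∀ e, 0 ≤ p e) (hp1 : ∀ e, p e ≤ 1) (hg : ∀ i, 0 ≤ g i)
    (hT : ∀ x y z, p s(x, y) * p s(y, z) * p s(x, z) ≤ g x * g y * g z) :
    ∏ e ∈ circulantEdges k 1 ∪ circulantEdges k (1 + 1), p e ≤ ∏ i, g i := by
  set c := ∏ e ∈ circulantEdges k 1, p e with hc
  set q := ∏ e ∈ circulantEdges k (1 + 1), p e with hq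
  rw [Finset.prod_union (disjoint_circulantEdges hk), ← hc, ← hq]
  have c0 : 0 ≤ c := Finset.prod_nonneg fun e _ => hp0 e
  have q0 : 0 ≤ q := Finset.prod_nonneg fun e _ => hp0 e
  have c1 : c ≤ 1 := Finset.prod_le_one (fun e _ => hp0 e) fun e _ => hp1 e
  have q1 : q ≤ 1 := Finset.prod_le_one (fun e _ => hp0 e) fun e _ => hp1 e
  have hcp : ∏ i, p s(i, i + 1) = c := by
    rw [hc, circulantEdges, Finset.prod_image fun i _ j _ h =>
      circulant_one_injective (by omega) h]
  have hcp' : ∏ i, p s(i + 1, i + 1 + 1) = c := by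
    rw [← hcp]
    exact Fintype.prod_equiv (Equiv.addRight 1) _ _ fun i => rfl
  have hqp : q ^ 2 ≤ ∏ i, p s(i, i + (1 + 1)) := by
    rw [Finset.prod_comp p fun i => s(i, i + (1 + 1)), hq, ← Finset.prod_pow]
    refine Finset.prod_le_prod (fun e _ => by positivity [hp0 e]) fun e _ => ?_
    exact pow_le_pow_of_le_one (hp0 e) (hp1 e) (card_filter_circulant_le k _ e)
  have hgs : ∏ i, g (i + 1) = ∏ i, g i :=
    Fintype.prod_equiv (Equiv.addRight 1) _ _ fun i => rfl
  have hgs' : ∏ i, g (i + 1 + 1) = ∏ i, g i := by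
    rw [← hgs]
    exact Fintype.prod_equiv (Equiv.addRight 1) _ _ fun i => rfl
  -- Over the triangles `i, i+1, i+2`, the step-1 edges contribute `c²` and the step-2 edges at
  -- least `q²`. Each vertex lies in three triangles, whence the cube on the right; the surplus `c q
  -- ≤ 1` is discarded.
  have key : (c * q) ^ 3 ≤ (∏ i, g i) ^ 3 := by
    calc (c * q) ^ 3 = c * c * q ^ 2 * (c * q) := by ring
      _ ≤ c * c * q ^ 2 * 1 := by gcongr; exact mul_le_one₀ c1 q0 q1
      _ ≤ c * c * ∏ i, p s(i, i + (1 + 1)) := by rw [mul_one]; gcongr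
      _ = ∏ i, (p s(i, i + 1) * p s(i + 1, i + 1 + 1) * p s(i, i + 1 + 1)) := by
          rw [Finset.prod_mul_distrib, Finset.prod_mul_distrib, hcp, hcp']
          simp only [add_assoc]
      _ ≤ ∏ i, (g i * g (i + 1) * g (i + 1 + 1)) := by
          refine Finset.prod_le_prod (fun i _ => ?_) fun i _ => hT _ _ _
          exact mul_nonneg (mul_nonneg (hp0 _) (hp0 _)) (hp0 _)
      _ = (∏ i, g i) ^ 3 := by
          rw [Finset.prod_mul_distrib, Finset.prod_mul_distrib, hgs, hgs']; ring
  exact le_of_pow_le_pow_left₀ three_ne_zero (Finset.prod_nonneg fun i _ => hg i) key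

theorem not_isDiag_of_mem_circulantEdges {k : ℕ} [NeZero k] {c : Fin k} (hc : c ≠ 0)
    {e : Sym2 (Fin k)} (he : e ∈ circulantEdges k c) : ¬ e.IsDiag := by
  simp only [circulantEdges, Finset.mem_image, Finset.mem_univ, true_and] at he
  obtain ⟨i, rfl⟩ := he
  simpa using hc

/-! ### Product measures -/

section ProductMeasure

variable {ι κ α : Type*} [Fintype ι] [Fintype κ] [MeasurableSpace α]

/-- Forgetting and relabelling coordinates preserves i.i.d. product measures. -/
theorem measurePreserving_pi_comp (ν : Measure α) [IsProbabilityMeasure ν] {f : κ → ι}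
    (hf : Function.Injective f) :
    MeasurePreserving (fun (x : ι → α) j => x (f j)) (Measure.pi fun _ => ν)
      (Measure.pi fun _ => ν) := by
  refine ⟨by fun_prop, ?_⟩
  have h1 : ProbabilityTheory.iIndepFun (fun (i : ι) (x : ι → α) => x i)
      (Measure.pi fun _ => ν) :=
    ProbabilityTheory.iIndepFun_pi (X := fun _ (x : α) => x) fun _ => aemeasurable_id
  have h2 := (ProbabilityTheory.iIndepFun_iff_map_fun_eq_pi_map (μ := Measure.pi fun _ : ι => ν)
    (f := fun (j : κ) (x : ι → α) => x (f j))
    (fun j => (measurable_pi_apply (f j)).aemeasurable)).1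
    (ProbabilityTheory.iIndepFun.precomp hf h1)
  rw [h2]
  congr 1
  funext j
  exact (measurePreserving_eval (fun _ : ι => ν) (f j)).map_eq

theorem lintegral_pi_prod (ν : Measure α) [IsProbabilityMeasure ν] {g : α → ENNReal}
    (hg : Measurable g) :
    ∫⁻ x : ι → α, ∏ i, g (x i) ∂(Measure.pi fun _ => ν) =
      (∫⁻ a, g a ∂ν) ^ Fintype.card ι := by
  have h1 : ProbabilityTheory.iIndepFun (fun (i : ι) (x : ι → α) => g (x i))
      (Measure.pi fun _ => ν) :=
    ProbabilityTheory.iIndepFun_pi (X := fun _ => g) fun _ => hg.aemeasurable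
  rw [ProbabilityTheory.lintegral_prod_eq_prod_lintegral_of_indepFun Finset.univ _ h1
    (fun i => by fun_prop)]
  rw [← Finset.card_univ, ← Finset.prod_const]
  refine Finset.prod_congr rfl fun i _ => ?_
  exact (measurePreserving_eval (fun _ : ι => ν) i).lintegral_comp hg

end ProductMeasure

/-! ### From expected counts to probabilities for fixed vertices -/

theorem cycleGraph_adj_iff_add_one {k : ℕ} [NeZero k] (hk : 2 ≤ k) {u v : Fin k}
    (h : (SimpleGraph.cycleGraph k).Adj u v) : v = u + 1 ∨ u = v + 1 := by
  rw [SimpleGraph.cycleGraph_adj'] at h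
  have h1 : ((1 : Fin k) : ℕ) = 1 := by rw [Fin.val_one', Nat.mod_eq_of_lt (by omega)]
  rcases h with h | h
  · right
    have : u - v = 1 := Fin.ext (h.trans h1.symm)
    rw [← this]; abel
  · left
    have : v - u = 1 := Fin.ext (h.trans h1.symm)
    rw [← this]; abel

open Classical in
/-- The `k`-sets whose increasing enumeration is a `k`-cycle give distinct copies of the cycle. -/
theorem card_filter_cycle_le_copyCount {k n : ℕ} [NeZero k] (hk : 2 ≤ k)
    (G : SimpleGraph (Fin n)) :
    (Finset.univ.filter fun s : {s : Finset (Fin n) // s.card = k} =>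
      ∀ i, G.Adj (s.1.orderEmbOfFin s.2 i) (s.1.orderEmbOfFin s.2 (i + 1))).card ≤
    G.copyCount (SimpleGraph.cycleGraph k) := by
  rw [SimpleGraph.copyCount_eq_card_image_copyToSubgraph]
  set T := Finset.univ.filter fun s : {s : Finset (Fin n) // s.card = k} =>
      ∀ i, G.Adj (s.1.orderEmbOfFin s.2 i) (s.1.orderEmbOfFin s.2 (i + 1)) with hT
  have hinj : Function.Injective fun s : {s : Finset (Fin n) // s.card = k} =>
      (s.1 : Set (Fin n)) := fun s t h => Subtype.ext (Finset.coe_injective h)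
  rw [← Finset.card_image_of_injective T hinj]
  -- Copies are separated by their vertex sets alone, so it suffices to find each `k`-set among
  -- these.
  refine le_trans (Finset.card_le_card ?_) (Finset.card_image_le (f := fun S => S.verts))
  intro A hA
  obtain ⟨s, hs, rfl⟩ := Finset.mem_image.1 hA
  have hs' := (Finset.mem_filter.1 hs).2
  let φ : SimpleGraph.cycleGraph k →g G := ⟨s.1.orderEmbOfFin s.2, fun {u v} huv => by
    rcases cycleGraph_adj_iff_add_one hk huv with rfl | rfl
    · exact hs' _
    · exact (hs' _).symm⟩
  refine Finset.mem_image.2 ⟨(φ.toCopy (s.1.orderEmbOfFin s.2).injective).toSubgraph,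
    Finset.mem_image_of_mem _ (Finset.mem_univ _), ?_⟩
  have : Set.range φ = s.1 := Finset.range_orderEmbOfFin s.1 s.2
  rw [← this, ← Set.image_univ]
  rfl

namespace RankOne

variable {τ : ℝ} {l : ℝ → ℝ}

instance : IsProbabilityMeasure (volume.restrict (Set.Icc (0 : ℝ) 1)) :=
  ⟨by simp⟩

instance [IsProbabilityMeasure (weightLaw τ l)] (n : ℕ) :
    IsProbabilityMeasure (randomness τ l n) := by
  unfold randomness; infer_instance

/-- There are finitely many graphs on `Fin n`, and each is specified by finitely many measurable
edge events. -/
theorem measurableSet_graph_mem {n : ℕ} (μ : ℝ) (S : Set (SimpleGraph (Fin n))) :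
    MeasurableSet {ω : (Fin n → ℝ) × (Sym2 (Fin n) → ℝ) | graph μ n ω.1 ω.2 ∈ S} := by
  have hadj : ∀ i j, MeasurableSet
      {ω : (Fin n → ℝ) × (Sym2 (Fin n) → ℝ) | (graph μ n ω.1 ω.2).Adj i j} := by
    intro i j
    have h1 : Measurable fun ω : (Fin n → ℝ) × (Sym2 (Fin n) → ℝ) => ω.2 s(i, j) := by fun_prop
    have h2 : Measurable fun ω : (Fin n → ℝ) × (Sym2 (Fin n) → ℝ) =>
        connProb μ n (ω.1 i) (ω.1 j) := by
      unfold connProb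
      fun_prop
    exact MeasurableSet.inter (MeasurableSet.const (i ≠ j)) (measurableSet_lt h1 h2)
  have hG : ∀ G : SimpleGraph (Fin n), MeasurableSet
      {ω : (Fin n → ℝ) × (Sym2 (Fin n) → ℝ) | graph μ n ω.1 ω.2 = G} := by
    intro G
    have : {ω : (Fin n → ℝ) × (Sym2 (Fin n) → ℝ) | graph μ n ω.1 ω.2 = G} =
        ⋂ i, ⋂ j, {ω | (graph μ n ω.1 ω.2).Adj i j ↔ G.Adj i j} := by
      ext ω
      simp only [Set.mem_iInter]
      exact ⟨fun h i j => by rw [Set.mem_ofPred_eq] at *; rw [h],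
        fun h => SimpleGraph.ext (by ext i j; exact h i j)⟩
    rw [this]
    exact MeasurableSet.iInter fun i => MeasurableSet.iInter fun j =>
      (hadj i j).iff (MeasurableSet.const _)
  have : {ω : (Fin n → ℝ) × (Sym2 (Fin n) → ℝ) | graph μ n ω.1 ω.2 ∈ S} =
      ⋃ G ∈ S, {ω | graph μ n ω.1 ω.2 = G} := by
    ext ω; simp
  rw [this]
  exact MeasurableSet.biUnion (Set.to_countable S) fun G _ => hG G

theorem integrable_graph [IsProbabilityMeasure (weightLaw τ l)] {n : ℕ} (μ : ℝ)
    (F : SimpleGraph (Fin n) → ℝ) :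
    Integrable (fun ω => F (graph μ n ω.1 ω.2)) (randomness τ l n) := by
  have hm : Measurable fun ω : (Fin n → ℝ) × (Sym2 (Fin n) → ℝ) => F (graph μ n ω.1 ω.2) :=
    fun t _ => measurableSet_graph_mem μ (F ⁻¹' t)
  obtain ⟨C, hC⟩ := (Set.finite_range fun G => ‖F G‖).bddAbove
  exact Integrable.of_bound hm.aestronglyMeasurable C
    (Eventually.of_forall fun ω => hC ⟨_, rfl⟩)

open Classical in
theorem integral_card_filter_graph [IsProbabilityMeasure (weightLaw τ l)] {n : ℕ} (μ : ℝ)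
    {ι : Type*} [Fintype ι] (p : ι → SimpleGraph (Fin n) → Prop) :
    ∫ ω, ((Finset.univ.filter fun i => p i (graph μ n ω.1 ω.2)).card : ℝ) ∂(randomness τ l n) =
      ∑ i, (randomness τ l n).real {ω | p i (graph μ n ω.1 ω.2)} := by
  have h1 : ∀ ω : (Fin n → ℝ) × (Sym2 (Fin n) → ℝ),
      ((Finset.univ.filter fun i => p i (graph μ n ω.1 ω.2)).card : ℝ) =
        ∑ i, if p i (graph μ n ω.1 ω.2) then (1 : ℝ) else 0 := fun ω => by
    rw [Finset.card_filter]; push_cast; rfl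
  simp only [h1]
  rw [integral_finsetSum _ fun i _ => integrable_graph μ fun G => if p i G then (1 : ℝ) else 0]
  refine Finset.sum_congr rfl fun i _ => ?_
  refine Eq.trans ?_ (integral_indicator_one (measurableSet_graph_mem μ {G | p i G}))
  refine integral_congr_ae (Eventually.of_forall fun ω => ?_)
  simp [Set.indicator_apply]

open Classical in
theorem sum_real_graph_le_integral [IsProbabilityMeasure (weightLaw τ l)] {n : ℕ} (μ : ℝ)
    {ι : Type*} [Fintype ι] (p : ι → SimpleGraph (Fin n) → Prop) (F : SimpleGraph (Fin n) → ℕ)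
    (hF : ∀ G, (Finset.univ.filter fun i => p i G).card ≤ F G) :
    ∑ i, (randomness τ l n).real {ω | p i (graph μ n ω.1 ω.2)} ≤
      ∫ ω, (F (graph μ n ω.1 ω.2) : ℝ) ∂(randomness τ l n) := by
  rw [← integral_card_filter_graph]
  exact integral_mono (integrable_graph μ fun G => ((Finset.univ.filter fun i => p i G).card : ℝ))
    (integrable_graph μ fun G => (F G : ℝ)) fun ω => Nat.cast_le.2 (hF _)

open Classical in
theorem integral_le_sum_real_graph [IsProbabilityMeasure (weightLaw τ l)] {n : ℕ} (μ : ℝ)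
    {ι : Type*} [Fintype ι] (p : ι → SimpleGraph (Fin n) → Prop) (F : SimpleGraph (Fin n) → ℕ)
    (hF : ∀ G, F G ≤ (Finset.univ.filter fun i => p i G).card) :
    ∫ ω, (F (graph μ n ω.1 ω.2) : ℝ) ∂(randomness τ l n) ≤
      ∑ i, (randomness τ l n).real {ω | p i (graph μ n ω.1 ω.2)} := by
  rw [← integral_card_filter_graph]
  exact integral_mono (integrable_graph μ fun G => (F G : ℝ))
    (integrable_graph μ fun G => ((Finset.univ.filter fun i => p i G).card : ℝ))
    fun ω => Nat.cast_le.2 (hF _)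

/-- Only the cycle through each `k`-set in increasing order is counted; the other cyclic orders
would change only a factor depending on `k`. -/
theorem le_avgCycles [IsProbabilityMeasure (weightLaw τ l)] {k n : ℕ} [NeZero k] (hk : 2 ≤ k)
    {c : ℝ} (hc : ∀ f : Fin k → Fin n, Function.Injective f → c ≤ (randomness τ l n).real
      {ω | ∀ i, (graph (meanWeight τ l) n ω.1 ω.2).Adj (f i) (f (i + 1))}) :
    n.choose k * c ≤ avgCycles τ l k n := by
  have h1 := sum_real_graph_le_integral (τ := τ) (l := l) (meanWeight τ l)
    (fun (s : {s : Finset (Fin n) // s.card = k}) (G : SimpleGraph (Fin n)) =>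
      ∀ i, G.Adj (s.1.orderEmbOfFin s.2 i) (s.1.orderEmbOfFin s.2 (i + 1)))
    (fun G => G.copyCount (SimpleGraph.cycleGraph k))
    fun G => by convert card_filter_cycle_le_copyCount hk G
  refine le_trans ?_ h1
  calc (n.choose k : ℝ) * c = ∑ _s : {s : Finset (Fin n) // s.card = k}, c := by
        simp [Fintype.card_finset_len]
    _ ≤ _ := Finset.sum_le_sum fun s _ => hc _ (s.1.orderEmbOfFin s.2).injective

open Classical in
theorem ncard_isNClique_le {k n : ℕ} (G : SimpleGraph (Fin n)) :
    Set.ncard {s : Finset (Fin n) | G.IsNClique k s} ≤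
      (Finset.univ.filter fun s : {s : Finset (Fin n) // s.card = k} =>
      ∀ i j, i ≠ j → G.Adj (s.1.orderEmbOfFin s.2 i) (s.1.orderEmbOfFin s.2 j)).card := by
  rw [← Finset.card_image_of_injective _ Subtype.val_injective, ← Set.ncard_coe_finset]
  refine Set.ncard_le_ncard (fun s hs => ?_) (Set.toFinite _)
  have hs' : G.IsNClique k s := hs
  simp only [Finset.coe_image, Set.mem_image]
  refine ⟨⟨s, hs'.card_eq⟩, ?_, rfl⟩
  refine Finset.mem_coe.2 (Finset.mem_filter.2 ⟨Finset.mem_univ _, fun i j hij => ?_⟩)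
  exact hs'.isClique (Finset.orderEmbOfFin_mem _ _ _) (Finset.orderEmbOfFin_mem _ _ _)
    fun h => hij ((s.orderEmbOfFin _).injective h)

theorem avgCliques_le [IsProbabilityMeasure (weightLaw τ l)] {k n : ℕ} {c : ℝ}
    (hc : ∀ f : Fin k → Fin n, Function.Injective f → (randomness τ l n).real
      {ω | ∀ i j, i ≠ j → (graph (meanWeight τ l) n ω.1 ω.2).Adj (f i) (f j)} ≤ c) :
    avgCliques τ l k n ≤ n.choose k * c := by
  have h1 := integral_le_sum_real_graph (τ := τ) (l := l) (meanWeight τ l)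
    (fun (s : {s : Finset (Fin n) // s.card = k}) (G : SimpleGraph (Fin n)) =>
      ∀ i j, i ≠ j → G.Adj (s.1.orderEmbOfFin s.2 i) (s.1.orderEmbOfFin s.2 j))
    (fun G => Set.ncard {s : Finset (Fin n) | G.IsNClique k s})
    fun G => by convert ncard_isNClique_le G
  refine le_trans h1 ?_
  calc _ ≤ ∑ _s : {s : Finset (Fin n) // s.card = k}, c :=
        Finset.sum_le_sum fun s _ => hc _ (s.1.orderEmbOfFin s.2).injective
    _ = (n.choose k : ℝ) * c := by simp [Fintype.card_finset_len]

/-! ### Probabilities of a given cycle and a given clique -/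

/-- If consecutive weights multiply to at least `μ n`, the cycle is present almost surely. -/
theorem pi_weightLaw_le_cycle [IsProbabilityMeasure (weightLaw τ l)] {k n : ℕ} [NeZero k]
    (hk : 2 ≤ k) {μ : ℝ} (hμ : 0 < μ * n) {f : Fin k → Fin n} (hf : Function.Injective f) :
    (Measure.pi fun _ : Fin k => weightLaw τ l) {x | ∀ i, μ * n ≤ x i * x (i + 1)} ≤
      randomness τ l n {ω | ∀ i, (graph μ n ω.1 ω.2).Adj (f i) (f (i + 1))} := by
  set E : Set (Fin k → ℝ) := {x | ∀ i, μ * n ≤ x i * x (i + 1)} with hE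
  have hEm : MeasurableSet E := by
    have : E = ⋂ i, {x : Fin k → ℝ | μ * n ≤ x i * x (i + 1)} := by ext; simp [hE]
    rw [this]
    exact MeasurableSet.iInter fun i => measurableSet_le (by fun_prop) (by fun_prop)
  -- Edges are defined by a strict inequality, so connection probability 1 still requires `u e < 1`,
  -- which holds almost surely.
  set B : Set (Sym2 (Fin n) → ℝ) := Set.univ.pi fun _ => Set.Iio 1 with hB
  have hBm : (Measure.pi fun _ : Sym2 (Fin n) => volume.restrict (Set.Icc (0 : ℝ) 1)) B = 1 := by
    rw [hB, Measure.pi_pi]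
    refine Finset.prod_eq_one fun e _ => ?_
    rw [Measure.restrict_apply measurableSet_Iio]
    have : Set.Iio (1 : ℝ) ∩ Set.Icc 0 1 = Set.Ico 0 1 := by
      ext x; simp only [Set.mem_inter_iff, Set.mem_Iio, Set.mem_Icc, Set.mem_Ico]
      constructor
      · rintro ⟨h1, h2, -⟩; exact ⟨h2, h1⟩
      · rintro ⟨h1, h2⟩; exact ⟨h2, h1, h2.le⟩
    rw [this]; simp
  have hsub : ((fun (x : Fin n → ℝ) j => x (f j)) ⁻¹' E) ×ˢ B ⊆
      {ω | ∀ i, (graph μ n ω.1 ω.2).Adj (f i) (f (i + 1))} := by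
    rintro ⟨h, u⟩ ⟨h1, h2⟩ i
    refine ⟨fun h3 => ?_, ?_⟩
    · have := hf h3
      have h4 : (1 : Fin k) = 0 := by simpa using this
      have h5 : ((1 : Fin k) : ℕ) = 1 := by rw [Fin.val_one', Nat.mod_eq_of_lt (by omega)]
      rw [h4] at h5; simp at h5
    · have h6 : connProb μ n (h (f i)) (h (f (i + 1))) = 1 :=
        min_eq_right ((one_le_div hμ).2 (h1 i))
      rw [h6]
      exact h2 _ (Set.mem_univ _)
  refine le_trans (le_of_eq ?_) (measure_mono hsub)
  rw [randomness, Measure.prod_prod, hBm, mul_one,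
    (measurePreserving_pi_comp (weightLaw τ l) hf).measure_preimage hEm.nullMeasurableSet]

/-- The connection probability of the pair `e`, for the rescaled absolute weights. -/
noncomputable def scaledProb {k : ℕ} (s : ℝ) (x : Fin k → ℝ) (e : Sym2 (Fin k)) : ℝ :=
  Sym2.lift ⟨fun i j => min (|x i| / s * (|x j| / s)) 1, fun i j => by
    simp only [mul_comm]⟩ e

theorem scaledProb_mk {k : ℕ} (s : ℝ) (x : Fin k → ℝ) (i j : Fin k) :
    scaledProb s x s(i, j) = min (|x i| / s * (|x j| / s)) 1 := rfl

theorem measurable_scaledProb {k : ℕ} (s : ℝ) (e : Sym2 (Fin k)) :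
    Measurable fun x : Fin k → ℝ => scaledProb s x e := by
  induction e using Sym2.ind with
  | _ i j => simp only [scaledProb_mk]; fun_prop

/-- Forgetting the edges outside `E` only enlarges the event, and given the weights the retained
edges are independent. Absolute values can only raise the probabilities, and make them nonnegative
for every `x`. -/
theorem clique_le_lintegral [IsProbabilityMeasure (weightLaw τ l)] {k n : ℕ}
    {μ : ℝ} (hμ : 0 < μ * n) {f : Fin k → Fin n} (hf : Function.Injective f)
    (E : Finset (Sym2 (Fin k))) (hE : ∀ e ∈ E, ¬ e.IsDiag) :
    randomness τ l n {ω | ∀ i j, i ≠ j → (graph μ n ω.1 ω.2).Adj (f i) (f j)} ≤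
      ∫⁻ x, ∏ e ∈ E, ENNReal.ofReal (scaledProb √(μ * n) x e)
        ∂(Measure.pi fun _ : Fin k => weightLaw τ l) := by
  classical
  set s := √(μ * n) with hs
  set D : Set ((Fin k → ℝ) × (Sym2 (Fin k) → ℝ)) :=
    {ω | ∀ e ∈ E, ω.2 e < scaledProb s ω.1 e} with hD
  have hDm : MeasurableSet D := by
    have : D = ⋂ e ∈ E, {ω : (Fin k → ℝ) × (Sym2 (Fin k) → ℝ) | ω.2 e < scaledProb s ω.1 e} := by
      ext; simp [hD]
    rw [this]
    exact MeasurableSet.biInter (Set.to_countable _) fun e _ =>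
      measurableSet_lt (by fun_prop) ((measurable_scaledProb s e).comp measurable_fst)
  have hmp := (measurePreserving_pi_comp (weightLaw τ l) hf).prod
    (measurePreserving_pi_comp (volume.restrict (Set.Icc (0 : ℝ) 1)) (Sym2.map.injective hf))
  have hsub : {ω | ∀ i j, i ≠ j → (graph μ n ω.1 ω.2).Adj (f i) (f j)} ⊆
      (Prod.map (fun (x : Fin n → ℝ) j => x (f j))
        (fun (u : Sym2 (Fin n) → ℝ) e => u (Sym2.map f e))) ⁻¹' D := by
    rintro ⟨h, u⟩ hω e he
    have hd := hE e he
    clear he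
    induction e using Sym2.ind with
    | _ i j =>
    have h1 := (hω i j (by simpa using hd)).2
    refine lt_of_lt_of_le h1 ?_
    rw [scaledProb_mk, connProb]
    refine min_le_min_right _ ?_
    rw [div_mul_div_comm, hs, Real.mul_self_sqrt hμ.le, ← abs_mul]
    gcongr
    exact le_abs_self _
  refine (measure_mono hsub).trans ?_
  rw [randomness, hmp.measure_preimage hDm.nullMeasurableSet, Measure.prod_apply hDm]
  refine lintegral_mono fun x => ?_
  have hbox : Prod.mk x ⁻¹' D =
      Set.univ.pi fun e => if e ∈ E then Set.Iio (scaledProb s x e) else Set.univ := by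
    ext v
    simp only [hD, Set.mem_preimage, Set.mem_ofPred_eq, Set.mem_pi, Set.mem_univ, true_imp_iff]
    refine forall_congr' fun e => ?_
    by_cases he : e ∈ E <;> simp [he]
  rw [hbox, Measure.pi_pi]
  calc _ ≤ ∏ e, if e ∈ E then ENNReal.ofReal (scaledProb s x e) else 1 := by
        refine Finset.prod_le_prod' fun e _ => ?_
        by_cases he : e ∈ E
        · simp only [he, if_true]
          rw [Measure.restrict_apply measurableSet_Iio]
          refine (measure_mono (t := Set.Ico 0 (scaledProb s x e)) fun y hy =>
            ⟨hy.2.1, hy.1⟩).trans ?_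
          simp
        · simp only [he, if_false]; exact prob_le_one
    _ = _ := by rw [Finset.prod_ite_mem, Finset.univ_inter]

theorem clique_le_twoPower [IsProbabilityMeasure (weightLaw τ l)] {k n : ℕ} (hk : 4 ≤ k)
    {μ : ℝ} (hμ : 0 < μ * n) {f : Fin k → Fin n} (hf : Function.Injective f)
    {a b : ℝ} (ha1 : 1 ≤ a) (ha2 : a ≤ 2) (hab : a ≤ 2 * b) (hab' : 2 * a - 2 ≤ b) :
    randomness τ l n {ω | ∀ i j, i ≠ j → (graph μ n ω.1 ω.2).Adj (f i) (f j)} ≤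
      (∫⁻ h, ENNReal.ofReal (twoPower a b (|h| / √(μ * n))) ∂(weightLaw τ l)) ^ k := by
  have : NeZero k := ⟨by omega⟩
  have hone : (1 : Fin k) ≠ 0 := by
    intro h4
    have h5 : ((1 : Fin k) : ℕ) = 1 := by rw [Fin.val_one', Nat.mod_eq_of_lt (by omega)]
    rw [h4] at h5; simp at h5
  have hs : 0 < √(μ * n) := Real.sqrt_pos.2 hμ
  refine (clique_le_lintegral hμ hf (circulantEdges k 1 ∪ circulantEdges k (1 + 1)) ?_).trans ?_
  · intro e he
    rcases Finset.mem_union.1 he with he | he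
    · exact not_isDiag_of_mem_circulantEdges hone he
    · exact not_isDiag_of_mem_circulantEdges (one_add_one_ne_zero_fin (by omega)) he
  · have h1 := lintegral_pi_prod (ι := Fin k) (weightLaw τ l)
      (g := fun h => ENNReal.ofReal (twoPower a b (|h| / √(μ * n))))
      (((measurable_twoPower a b).comp (by fun_prop)).ennreal_ofReal)
    rw [Fintype.card_fin] at h1
    rw [← h1]
    refine lintegral_mono fun x => ?_
    have hx : ∀ i, 0 ≤ |x i| / √(μ * n) := fun i => by positivity
    have hp0 : ∀ e, 0 ≤ scaledProb √(μ * n) x e := fun e => by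
      induction e using Sym2.ind with
      | _ i j => rw [scaledProb_mk]; exact le_min (mul_nonneg (hx i) (hx j)) zero_le_one
    rw [← ENNReal.ofReal_prod_of_nonneg fun e _ => hp0 e,
      ← ENNReal.ofReal_prod_of_nonneg fun i _ => twoPower_nonneg (hx i)]
    refine ENNReal.ofReal_le_ofReal (prod_circulantEdges_le hk hp0 (fun e => ?_)
      (fun i => twoPower_nonneg (hx i)) fun y z w => ?_)
    · induction e using Sym2.ind with
      | _ i j => rw [scaledProb_mk]; exact min_le_right _ _
    · simp only [scaledProb_mk]
      exact triangle_le_twoPower ha1 ha2 hab hab' (hx y) (hx z) (hx w)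

end RankOne

/-! ### Cycle probability from alternating boxes -/

theorem prod_fin_ite_even {M : Type*} [CommMonoid M] (m : ℕ) (a b : M) :
    ∏ i : Fin (2 * m), (if Even (i : ℕ) then a else b) = a ^ m * b ^ m := by
  rw [Fin.prod_univ_eq_prod_range (fun i => if Even i then a else b)]
  induction m with
  | zero => simp
  | succ m ih =>
    rw [mul_add, mul_one, Finset.prod_range_succ, Finset.prod_range_succ, ih, if_pos (by simp),
      if_neg (by simp), pow_succ, pow_succ, mul_mul_mul_comm, mul_assoc]

/-- The wrap from `k - 1` to `0` also flips parity because `k` is even; this is what lets weights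
alternate consistently around the cycle. -/
theorem fin_even_add_one_iff {k : ℕ} [NeZero k] (hk : Even k) (i : Fin k) :
    Even ((i + 1 : Fin k) : ℕ) ↔ ¬ Even (i : ℕ) := by
  have hk1 : 1 < k := by
    obtain ⟨r, rfl⟩ := hk
    have := NeZero.ne (r + r)
    omega
  rw [Fin.val_add, Fin.val_one', Nat.mod_eq_of_lt hk1]
  have hi := i.2
  rcases (Nat.succ_le_of_lt hi).eq_or_lt with h | h
  · have h' : (i : ℕ) + 1 = k := h
    rw [h', Nat.mod_self]
    simp only [Even.zero, true_iff]
    rw [← h', Nat.even_add_one] at hk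
    exact hk
  · rw [Nat.mod_eq_of_lt h, Nat.even_add_one]

/-- Averaging over the scale `t` of alternating boxes `(t, 2t]`, `(N/t, 2N/t]` bounds from below
the probability that cyclically consecutive coordinates multiply to at least `N`. -/
theorem lintegral_alternating_boxes_le (ρ : Measure ℝ) [IsProbabilityMeasure ρ] {m : ℕ}
    [NeZero (2 * m)] {N s T : ℝ} (hN : 0 ≤ N) (hs : 0 < s) :
    ∫⁻ t in Set.Ioc s T, ENNReal.ofReal t⁻¹ *
        (ρ (Set.Ioc t (2 * t)) ^ m * ρ (Set.Ioc (N / t) (2 * (N / t))) ^ m) ≤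
      (Measure.pi fun _ : Fin (2 * m) => ρ) {x | ∀ i, N ≤ x i * x (i + 1)} := by
  set W : ℝ → Fin (2 * m) → ℝ := fun t i => if Even (i : ℕ) then t else N / t with hW
  have hWm : ∀ i, Measurable fun t => W t i := fun i => by
    simp only [hW]; split_ifs <;> fun_prop
  set Q : Set (ℝ × (Fin (2 * m) → ℝ)) :=
    {q | ∀ i, q.2 i ∈ Set.Ioc (W q.1 i) (2 * W q.1 i)} with hQ
  have hQm : MeasurableSet Q := by
    have : Q = ⋂ i, {q : ℝ × (Fin (2 * m) → ℝ) | W q.1 i < q.2 i} ∩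
        {q | q.2 i ≤ 2 * W q.1 i} := by
      ext q
      simp only [hQ, Set.mem_iInter]
      exact Iff.rfl
    rw [this]
    refine MeasurableSet.iInter fun i => MeasurableSet.inter (measurableSet_lt ?_ ?_)
      (measurableSet_le ?_ ?_)
    · exact (hWm i).comp measurable_fst
    · fun_prop
    · fun_prop
    · exact ((hWm i).comp measurable_fst).const_mul 2
  set E : Set (Fin (2 * m) → ℝ) := {x | ∀ i, N ≤ x i * x (i + 1)} with hE
  have hEm : MeasurableSet E := by
    have : E = ⋂ i, {x : Fin (2 * m) → ℝ | N ≤ x i * x (i + 1)} := by ext; simp [hE]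
    rw [this]
    exact MeasurableSet.iInter fun i => measurableSet_le (by fun_prop) (by fun_prop)
  have hbox : ∀ t, ENNReal.ofReal t⁻¹ *
        (ρ (Set.Ioc t (2 * t)) ^ m * ρ (Set.Ioc (N / t) (2 * (N / t))) ^ m) =
      ∫⁻ x, ENNReal.ofReal t⁻¹ * Q.indicator 1 (t, x) ∂(Measure.pi fun _ : Fin (2 * m) => ρ) := by
    intro t
    have hsec : MeasurableSet (Prod.mk t ⁻¹' Q) := measurable_prodMk_left hQm
    have hind : Measurable fun x => Q.indicator (1 : ℝ × (Fin (2 * m) → ℝ) → ENNReal) (t, x) :=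
      (measurable_one.indicator hQm).comp measurable_prodMk_left
    rw [lintegral_const_mul _ hind]
    congr 1
    have h1 : ∀ x, Q.indicator (1 : ℝ × (Fin (2 * m) → ℝ) → ENNReal) (t, x) =
        (Prod.mk t ⁻¹' Q).indicator 1 x := fun x => by
      by_cases h : (t, x) ∈ Q
      · rw [Set.indicator_of_mem h, Set.indicator_of_mem (show x ∈ Prod.mk t ⁻¹' Q from h)]; rfl
      · rw [Set.indicator_of_notMem h, Set.indicator_of_notMem (show x ∉ Prod.mk t ⁻¹' Q from h)]
    simp only [h1]
    rw [lintegral_indicator_one hsec]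
    have h2 : Prod.mk t ⁻¹' Q = Set.univ.pi fun i => Set.Ioc (W t i) (2 * W t i) := by
      ext x; simp [hQ]
    rw [h2, Measure.pi_pi, ← prod_fin_ite_even]
    refine Finset.prod_congr rfl fun i _ => ?_
    simp only [hW]
    split_ifs <;> rfl
  simp only [hbox]
  rw [lintegral_lintegral_swap]
  swap
  · exact ((ENNReal.measurable_ofReal.comp (measurable_inv.comp measurable_fst)).mul
      (measurable_one.indicator hQm)).aemeasurable
  rw [← lintegral_indicator_one hEm]
  refine lintegral_mono fun x => ?_
  by_cases hx : x ∈ E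
  · rw [Set.indicator_of_mem hx, Pi.one_apply]
    set y := x 0 with hy
    -- The coordinate `y = x 0` alone confines `t` to `[y/2, y)`. There `1/t ≤ 2/y` on a set of
    -- length `y/2`, so the total multiplicity is at most 1.
    calc ∫⁻ t in Set.Ioc s T, ENNReal.ofReal t⁻¹ * Q.indicator 1 (t, x)
        ≤ ∫⁻ t in Set.Ioc s T, (Set.Ico (y / 2) y).indicator
            (fun _ => ENNReal.ofReal (2 / y)) t := by
          refine setLIntegral_mono (measurable_const.indicator measurableSet_Ico) fun t ht => ?_
          by_cases hq : (t, x) ∈ Q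
          · have h0 := hq 0
            simp only [hW, Fin.val_zero, Even.zero, if_true] at h0
            have t0 : 0 < t := hs.trans ht.1
            have y0 : 0 < y := t0.trans h0.1
            have hty : t ∈ Set.Ico (y / 2) y := ⟨by linarith [h0.2], h0.1⟩
            rw [Set.indicator_of_mem hq, Set.indicator_of_mem hty, Pi.one_apply, mul_one]
            refine ENNReal.ofReal_le_ofReal ?_
            rw [inv_le_comm₀ t0 (by positivity), inv_div]
            exact hty.1
          · rw [Set.indicator_of_notMem hq, mul_zero]; exact zero_le
      _ ≤ ∫⁻ t, (Set.Ico (y / 2) y).indicator (fun _ => ENNReal.ofReal (2 / y)) t :=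
          setLIntegral_le_lintegral _ _
      _ = ENNReal.ofReal (2 / y) * ENNReal.ofReal (y / 2) := by
          rw [lintegral_indicator_const measurableSet_Ico, Real.volume_Ico]
          congr 2; ring
      _ ≤ 1 := by
          rcases le_or_gt y 0 with h | h
          · rw [ENNReal.ofReal_of_nonpos (p := y / 2) (by linarith), mul_zero]
            exact zero_le_one
          · rw [← ENNReal.ofReal_mul (by positivity), div_mul_div_comm, mul_comm 2 y,
              div_self (by positivity), ENNReal.ofReal_one]
  · rw [Set.indicator_of_notMem hx]
    refine le_of_eq ((setLIntegral_congr_fun measurableSet_Ioc fun t ht => ?_).trans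
      (lintegral_zero))
    have t0 : 0 < t := hs.trans ht.1
    have hq : (t, x) ∉ Q := by
      intro hq
      refine hx fun i => ?_
      have hi := (hq i).1
      have hi' := (hq (i + 1)).1
      simp only [hW, fin_even_add_one_iff (even_two_mul m)] at hi hi'
      have hNt : 0 ≤ N / t := by positivity
      by_cases he : Even (i : ℕ)
      · simp only [he, not_true_eq_false, if_true, if_false] at hi hi'
        calc N = t * (N / t) := by field_simp
          _ ≤ _ := mul_le_mul hi.le hi'.le hNt (t0.le.trans hi.le)
      · simp only [he, not_false_eq_true, if_true, if_false] at hi hi'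
        calc N = (N / t) * t := by field_simp
          _ ≤ _ := mul_le_mul hi.le hi'.le t0.le (hNt.trans hi.le)
    rw [Set.indicator_of_notMem hq, mul_zero]

/-- The integrand `l(t) ^ m l(N / t) ^ m / t`. -/
noncomputable def cycleKernel (l : ℝ → ℝ) (m : ℕ) (N t : ℝ) : ℝ :=
  t⁻¹ * (l t ^ m * l (N / t) ^ m)

theorem measurable_cycleKernel {l : ℝ → ℝ} (hl : Measurable l) (m : ℕ) (N : ℝ) :
    Measurable (cycleKernel l m N) := by
  unfold cycleKernel; fun_prop

theorem cycleKernel_nonneg {l : ℝ → ℝ} (hl0 : ∀ h : ℝ, 1 ≤ h → 0 ≤ l h) (m : ℕ) {N t : ℝ}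
    (ht : 1 ≤ t) (htN : t ≤ N) : 0 ≤ cycleKernel l m N t := by
  have h1 := hl0 t ht
  have h2 := hl0 (N / t) ((one_le_div (by linarith)).2 htN)
  unfold cycleKernel; positivity

/-- The substitution `x = N/t`, with Jacobian `N/t²`, maps the range into `[1, M]`. -/
theorem lintegral_Ioc_div_comp_le {g : ℝ → ENNReal} {N M : ℝ} (hN : 0 < N) (hM : 1 ≤ M) :
    ∫⁻ t in Set.Ioc (N / M) N, ENNReal.ofReal (N / t ^ 2) * g (N / t) ≤
      ∫⁻ x in Set.Icc 1 M, g x := by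
  have hpos : ∀ t ∈ Set.Ioc (N / M) N, 0 < t := fun t ht =>
    lt_of_le_of_lt (by positivity) ht.1
  have h := lintegral_image_eq_lintegral_abs_deriv_mul (s := Set.Ioc (N / M) N)
    (f := fun t => N / t) (f' := fun t => -(N / t ^ 2)) measurableSet_Ioc
    (fun t ht => by
      have h := ((hasDerivAt_inv (hpos t ht).ne').const_mul N).hasDerivWithinAt
        (s := Set.Ioc (N / M) N)
      simpa only [div_eq_mul_inv, mul_neg] using h)
    (fun x hx y hy hxy => by
      have hx0 := hpos x hx
      have hy0 := hpos y hy
      have hxy' : N / x = N / y := hxy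
      field_simp at hxy'
      linarith) g
  calc ∫⁻ t in Set.Ioc (N / M) N, ENNReal.ofReal (N / t ^ 2) * g (N / t)
      = ∫⁻ t in Set.Ioc (N / M) N, ENNReal.ofReal |-(N / t ^ 2)| * g (N / t) := by
        refine setLIntegral_congr_fun measurableSet_Ioc fun t ht => ?_
        have := hpos t ht
        simp only [abs_neg, abs_of_pos (show 0 < N / t ^ 2 by positivity)]
    _ = _ := h.symm
    _ ≤ _ := by
        refine lintegral_mono_set ?_
        rintro _ ⟨t, ht, rfl⟩
        have t0 := hpos t ht
        refine ⟨(one_le_div t0).2 ht.2, ?_⟩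
        have := ht.1
        rw [div_lt_iff₀ (by linarith)] at this
        rw [div_le_iff₀ t0]; linarith

/-- The part of the integral over `(N / M, N]` is dominated by the part over `(N / 2M, N / M]`. -/
theorem lintegral_cycleKernel_end_le {l : ℝ → ℝ} (hl : Measurable l)
    (hl0 : ∀ h : ℝ, 1 ≤ h → 0 ≤ l h) {ε M : ℝ} (hε : 0 ≤ ε) (hP : PotterBound l ε M) {m : ℕ}
    (hint : LocallyIntegrableOn (fun h : ℝ => l h ^ m) (Set.Ici 1) volume) :
    ∃ C : ℝ, 0 ≤ C ∧ ∀ N, 2 * M ^ 2 ≤ N →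
      ∫⁻ t in Set.Ioc (N / M) N, ENNReal.ofReal (cycleKernel l m N t) ≤ ENNReal.ofReal C *
        ∫⁻ t in Set.Ioc (N / (2 * M)) (N / M), ENNReal.ofReal (cycleKernel l m N t) := by
  have M1 := hP.1
  have M0 : 0 < M := by linarith
  have lM := (hP.2 M le_rfl).1
  have hi : IntegrableOn (fun h : ℝ => l h ^ m) (Set.Icc 1 M) :=
    hint.integrableOn_compact_subset Set.Icc_subset_Ici_self isCompact_Icc
  set A : ℝ := ∫ x in Set.Icc 1 M, l x ^ m with hA
  have hA' : ∫⁻ x in Set.Icc 1 M, ENNReal.ofReal (l x ^ m) = ENNReal.ofReal A := by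
    rw [hA, ofReal_integral_eq_lintegral_ofReal hi]
    filter_upwards [ae_restrict_mem measurableSet_Icc] with x hx
    exact pow_nonneg (hl0 x hx.1) _
  have A0 : 0 ≤ A := setIntegral_nonneg measurableSet_Icc fun x hx => pow_nonneg (hl0 x hx.1) _
  -- `K` is the Potter constant for two points beyond `M` within a factor `2M`.
  obtain ⟨K, hK⟩ : ∃ K : ℝ, K = Real.exp ε * (2 * M) ^ ε := ⟨_, rfl⟩
  have K0 : 0 < K := by rw [hK]; positivity
  -- The constant is the quotient of the bounds `upper` and `lower` below; `l z ^ m` cancels, which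
  -- makes it independent of `N`.
  refine ⟨K ^ m * A * (2 * (K * K) ^ m / l M ^ m), by positivity, fun N hN => ?_⟩
  have N0 : 0 < N := lt_of_lt_of_le (by positivity) hN
  set z := N / (2 * M) with hz
  have z0 : 0 < z := by positivity
  have hzM : M ≤ z := by rw [hz, le_div_iff₀ (by positivity)]; linarith [sq M]
  have lz := (hP.2 z hzM).1
  have hNM : N / M = 2 * z := by rw [hz]; field_simp
  have hN2 : N = 2 * M * z := by rw [hz]; field_simp
  have hratio : ∀ x y : ℝ, M ≤ x → x ≤ y → y ≤ 2 * M * x → l y ≤ K * l x ∧ l x ≤ K * l y := by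
    intro x y hx hxy hy
    have x0 : 0 < x := by linarith
    have hlx := (hP.2 x hx).1
    have hly := (hP.2 y (hx.trans hxy)).1
    have : (y / x) ^ ε ≤ (2 * M) ^ ε := by
      have h1 : y / x ≤ 2 * M := by rw [div_le_iff₀ x0]; exact hy
      exact Real.rpow_le_rpow (div_nonneg (by linarith) x0.le) h1 hε
    obtain ⟨h1, h2⟩ := (hP.2 x hx).2 y hxy
    rw [hK]
    exact ⟨h1.trans (by gcongr), h2.trans (by gcongr)⟩
  have upper : ∫⁻ t in Set.Ioc (N / M) N, ENNReal.ofReal (cycleKernel l m N t) ≤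
      ENNReal.ofReal ((K * l z) ^ m * A) := by
    calc ∫⁻ t in Set.Ioc (N / M) N, ENNReal.ofReal (cycleKernel l m N t)
        ≤ ∫⁻ t in Set.Ioc (N / M) N, ENNReal.ofReal ((K * l z) ^ m) *
          (ENNReal.ofReal (N / t ^ 2) * ENNReal.ofReal (l (N / t) ^ m)) := by
          refine setLIntegral_mono (by fun_prop) fun t ht => ?_
          have ht1 := ht.1
          rw [hNM] at ht1
          have t0 : 0 < t := by linarith
          have hNt : 1 ≤ N / t := (one_le_div t0).2 ht.2
          have hlNt := hl0 _ hNt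
          have hlt := (hP.2 t (by linarith)).1
          rw [← ENNReal.ofReal_mul (by positivity), ← ENNReal.ofReal_mul (by positivity)]
          refine ENNReal.ofReal_le_ofReal ?_
          have e1 : l t ^ m ≤ (K * l z) ^ m :=
            pow_le_pow_left₀ hlt.le (hratio z t hzM (by linarith) (by linarith [ht.2])).1 m
          -- Since `t ≤ N`, the factor `1/t` is dominated by the Jacobian of `t ↦ N/t`, so the
          -- integral of `l^m` over `[1, M]` appears.
          have e2 : t⁻¹ ≤ N / t ^ 2 := by
            rw [sq, ← div_div, inv_eq_one_div]; gcongr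
          calc cycleKernel l m N t = l t ^ m * (t⁻¹ * l (N / t) ^ m) := by
                unfold cycleKernel; ring
            _ ≤ _ := by gcongr
      _ = ENNReal.ofReal ((K * l z) ^ m) * ∫⁻ t in Set.Ioc (N / M) N,
          (ENNReal.ofReal (N / t ^ 2) * ENNReal.ofReal (l (N / t) ^ m)) :=
          lintegral_const_mul _ (by fun_prop)
      _ ≤ ENNReal.ofReal ((K * l z) ^ m) * ENNReal.ofReal A := by
          rw [← hA']
          exact mul_le_mul_right (lintegral_Ioc_div_comp_le
            (g := fun x => ENNReal.ofReal (l x ^ m)) N0 M1) _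
      _ = _ := by rw [← ENNReal.ofReal_mul (by positivity)]
  have lower : ENNReal.ofReal (2⁻¹ * ((l z / K) ^ m * (l M / K) ^ m)) ≤
      ∫⁻ t in Set.Ioc z (N / M), ENNReal.ofReal (cycleKernel l m N t) := by
    calc ENNReal.ofReal (2⁻¹ * ((l z / K) ^ m * (l M / K) ^ m))
        = ∫⁻ t in Set.Ioc z (N / M),
            ENNReal.ofReal ((2 * z)⁻¹ * ((l z / K) ^ m * (l M / K) ^ m)) := by
          rw [setLIntegral_const, Real.volume_Ioc, ← ENNReal.ofReal_mul (by positivity), hNM]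
          congr 1
          field_simp
          ring
      _ ≤ _ := by
          refine setLIntegral_mono (measurable_cycleKernel hl m N).ennreal_ofReal fun t ht => ?_
          have ht2 := ht.2
          rw [hNM] at ht2
          have t0 : 0 < t := z0.trans ht.1
          have hNt : M ≤ N / t := by rw [le_div_iff₀ t0, hN2]; nlinarith
          have e1 : l z / K ≤ l t := by
            rw [div_le_iff₀' K0]
            exact (hratio z t hzM ht.1.le (by nlinarith)).2
          have e2 : l M / K ≤ l (N / t) := by
            rw [div_le_iff₀' K0]
            refine (hratio M (N / t) le_rfl hNt ?_).2
            rw [div_le_iff₀ t0, hN2]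
            have : z ≤ M * t := by nlinarith [ht.1]
            nlinarith
          refine ENNReal.ofReal_le_ofReal ?_
          unfold cycleKernel
          have e3 : (2 * z)⁻¹ ≤ t⁻¹ := by gcongr
          have e4 : 0 ≤ l z / K := by positivity
          have e5 : 0 ≤ l M / K := by positivity
          have e6 : 0 ≤ l t := e4.trans e1
          gcongr
  calc _ ≤ ENNReal.ofReal ((K * l z) ^ m * A) := upper
    _ = ENNReal.ofReal (K ^ m * A * (2 * (K * K) ^ m / l M ^ m)) *
        ENNReal.ofReal (2⁻¹ * ((l z / K) ^ m * (l M / K) ^ m)) := by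
        rw [← ENNReal.ofReal_mul (by positivity)]
        congr 1
        rw [div_pow, div_pow, mul_pow, mul_pow]
        field_simp
    _ ≤ _ := by gcongr

namespace RankOne

variable {τ : ℝ} {l : ℝ → ℝ} {ε M : ℝ}

/-- As `t * (N/t) = N`, the powers in the box probabilities combine to one independent of `t`,
leaving the kernel. Stopping at `N/M` keeps `N/t ≥ M`, as Potter's bounds require. -/
theorem lintegral_cycleKernel_le_pi [IsProbabilityMeasure (weightLaw τ l)] (hl : Measurable l)
    (hP : PotterBound l ε M) (hε : 0 ≤ ε) (hτ : 0 ≤ τ) {m : ℕ} [NeZero (2 * m)] {N : ℝ}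
    (hN : M ^ 2 ≤ N) :
    ENNReal.ofReal ((2 ^ (-τ) * (Real.exp ε * 2 ^ ε)⁻¹) ^ (2 * m) * (√N ^ (1 - τ)) ^ (2 * m)) *
        ∫⁻ t in Set.Ioc √N (N / M), ENNReal.ofReal (cycleKernel l m N t) ≤
      (Measure.pi fun _ : Fin (2 * m) => weightLaw τ l) {x | ∀ i, N ≤ x i * x (i + 1)} := by
  have M1 := hP.1
  have M0 : 0 < M := by linarith
  have N0 : 0 < N := lt_of_lt_of_le (by positivity) hN
  have hs : 0 < √N := Real.sqrt_pos.2 N0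
  have hsM : M ≤ √N := Real.le_sqrt_of_sq_le hN
  obtain ⟨c, hc⟩ : ∃ c : ℝ, c = 2 ^ (-τ) * (Real.exp ε * 2 ^ ε)⁻¹ := ⟨_, rfl⟩
  have c0 : 0 < c := by rw [hc]; positivity
  rw [← hc, ← lintegral_const_mul _ (measurable_cycleKernel hl m N).ennreal_ofReal]
  refine le_trans ?_ (lintegral_alternating_boxes_le (weightLaw τ l) (T := N / M) N0.le hs)
  refine setLIntegral_mono_ae' measurableSet_Ioc (Eventually.of_forall fun t ht => ?_)
  have t0 : 0 < t := hs.trans ht.1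
  have htM : M ≤ t := hsM.trans ht.1.le
  have hNt : M ≤ N / t := by
    rw [le_div_iff₀ t0, mul_comm, ← le_div_iff₀ M0]; exact ht.2
  have lt := (hP.2 t htM).1
  have lNt := (hP.2 _ hNt).1
  have h1 := le_weightLaw_Ioc hl hP hε hτ htM
  have h2 := le_weightLaw_Ioc hl hP hε hτ hNt
  rw [← hc] at h1 h2
  have hNt0 : 0 < N / t := by positivity
  have hpow : (√N ^ (1 - τ)) ^ (2 * m) = (t ^ (1 - τ)) ^ m * ((N / t) ^ (1 - τ)) ^ m := by
    rw [← mul_pow, ← Real.mul_rpow t0.le hNt0.le, mul_div_cancel₀ _ t0.ne', pow_mul]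
    congr 1
    rw [sq, ← Real.mul_rpow hs.le hs.le, Real.mul_self_sqrt N0.le]
  calc ENNReal.ofReal (c ^ (2 * m) * (√N ^ (1 - τ)) ^ (2 * m)) *
        ENNReal.ofReal (cycleKernel l m N t)
      = ENNReal.ofReal t⁻¹ * (ENNReal.ofReal (c * (t ^ (1 - τ) * l t)) ^ m *
          ENNReal.ofReal (c * ((N / t) ^ (1 - τ) * l (N / t))) ^ m) := by
        rw [← ENNReal.ofReal_pow (by positivity), ← ENNReal.ofReal_pow (by positivity),
          ← ENNReal.ofReal_mul (by positivity), ← ENNReal.ofReal_mul (by positivity),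
          ← ENNReal.ofReal_mul (by positivity), hpow]
        congr 1
        unfold cycleKernel
        ring
    _ ≤ _ := by gcongr

/-- Lower bound for the probability of a cycle in terms of the integral of the cycle kernel. -/
theorem exists_mul_integral_cycleKernel_le [IsProbabilityMeasure (weightLaw τ l)]
    (hl : Measurable l) (hl0 : ∀ h : ℝ, 1 ≤ h → 0 ≤ l h) (hP : PotterBound l ε M) (hε : 0 ≤ ε)
    (hτ : 0 ≤ τ) {m : ℕ} [NeZero (2 * m)]
    (hint : LocallyIntegrableOn (fun h : ℝ => l h ^ m) (Set.Ici 1) volume) :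
    ∃ c : ℝ, 0 < c ∧ ∀ N, 4 * M ^ 2 ≤ N →
      IntegrableOn (cycleKernel l m N) (Set.Ioc √N N) ∧
      c * (√N ^ (1 - τ)) ^ (2 * m) * ∫ t in Set.Ioc √N N, cycleKernel l m N t ≤
        (Measure.pi fun _ : Fin (2 * m) => weightLaw τ l).real {x | ∀ i, N ≤ x i * x (i + 1)} := by
  obtain ⟨C, hC0, hC⟩ := lintegral_cycleKernel_end_le hl hl0 hε hP hint
  obtain ⟨c, hc⟩ : ∃ c : ℝ, c = (2 ^ (-τ) * (Real.exp ε * 2 ^ ε)⁻¹) ^ (2 * m) := ⟨_, rfl⟩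
  have c0 : 0 < c := by rw [hc]; positivity
  -- The whole integral is at most `1 + C` times its part up to `N/M`.
  refine ⟨c / (1 + C), by positivity, fun N hN => ?_⟩
  have M1 := hP.1
  have M0 : 0 < M := by linarith
  have hN2 : M ^ 2 ≤ N := by nlinarith [sq_nonneg M]
  have N0 : 0 < N := lt_of_lt_of_le (by positivity) hN2
  have hs : 0 < √N := Real.sqrt_pos.2 N0
  have hs1 : 1 ≤ √N := M1.trans (Real.le_sqrt_of_sq_le hN2)
  have hmid : √N ≤ N / (2 * M) := by
    rw [le_div_iff₀ (by positivity)]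
    have h1 : 2 * M ≤ √N := Real.le_sqrt_of_sq_le (by linarith [mul_pow 2 M 2])
    calc √N * (2 * M) ≤ √N * √N := by gcongr
      _ = N := Real.mul_self_sqrt N0.le
  have hmid' : N / (2 * M) ≤ N / M := by gcongr; linarith
  have hend : N / M ≤ N := div_le_self N0.le M1
  set J := ∫⁻ t in Set.Ioc √N (N / M), ENNReal.ofReal (cycleKernel l m N t) with hJ
  set P := (Measure.pi fun _ : Fin (2 * m) => weightLaw τ l) {x | ∀ i, N ≤ x i * x (i + 1)}
    with hPdef
  obtain ⟨r, hr⟩ : ∃ r : ℝ, r = (√N ^ (1 - τ)) ^ (2 * m) := ⟨_, rfl⟩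
  have r0 : 0 < r := by rw [hr]; positivity
  have hJP : ENNReal.ofReal (c * r) * J ≤ P := by
    have := lintegral_cycleKernel_le_pi hl hP hε hτ (m := m) hN2
    rwa [← hc, ← hr] at this
  have htot : ∫⁻ t in Set.Ioc √N N, ENNReal.ofReal (cycleKernel l m N t) ≤
      ENNReal.ofReal (1 + C) * J := by
    rw [← Set.Ioc_union_Ioc_eq_Ioc (hmid.trans hmid') hend,
      ENNReal.ofReal_add zero_le_one hC0, ENNReal.ofReal_one, add_mul, one_mul]
    refine (lintegral_union_le _ _ _).trans (add_le_add le_rfl ?_)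
    exact (hC N (by nlinarith [sq_nonneg M])).trans
      (mul_le_mul_right (lintegral_mono_set (Set.Ioc_subset_Ioc_left hmid)) _)
  -- Finiteness comes from the probability bound itself: a positive multiple of `J` is at most `P`.
  have hJfin : J ≠ ⊤ := by
    intro h
    rw [h, ENNReal.mul_top (by simpa using by positivity)] at hJP
    exact measure_ne_top _ _ (top_le_iff.1 hJP)
  have hnn : 0 ≤ᵐ[volume.restrict (Set.Ioc √N N)] cycleKernel l m N := by
    filter_upwards [ae_restrict_mem measurableSet_Ioc] with t ht
    exact cycleKernel_nonneg hl0 m (hs1.trans ht.1.le) ht.2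
  have hfin : ∫⁻ t in Set.Ioc √N N, ENNReal.ofReal (cycleKernel l m N t) < ⊤ :=
    htot.trans_lt (ENNReal.mul_lt_top ENNReal.ofReal_lt_top hJfin.lt_top)
  have hI : IntegrableOn (cycleKernel l m N) (Set.Ioc √N N) :=
    ⟨(measurable_cycleKernel hl m N).aestronglyMeasurable,
      (hasFiniteIntegral_iff_ofReal hnn).2 hfin⟩
  refine ⟨hI, ?_⟩
  rw [← hr]
  have hle : ENNReal.ofReal (c / (1 + C) * r * ∫ t in Set.Ioc √N N, cycleKernel l m N t) ≤ P := by
    rw [ENNReal.ofReal_mul (by positivity), ofReal_integral_eq_lintegral_ofReal hI hnn]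
    calc _ ≤ ENNReal.ofReal (c / (1 + C) * r) * (ENNReal.ofReal (1 + C) * J) := by gcongr
      _ = ENNReal.ofReal (c * r) * J := by
          rw [← mul_assoc, ← ENNReal.ofReal_mul (by positivity)]
          congr 2
          field_simp
      _ ≤ P := hJP
  exact (ENNReal.ofReal_le_iff_le_toReal (measure_ne_top _ _)).1 hle

end RankOne

/-! ### Divergence of the normalised integral -/

/-- The normalised kernel integral diverges. -/
theorem SlowlyVarying.tendsto_integral_cycleKernel {l : ℝ → ℝ} (hl : SlowlyVarying l)
    (hl0 : ∀ h : ℝ, 1 ≤ h → 0 ≤ l h) {m : ℕ}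
    (hI : ∀ᶠ N in atTop, IntegrableOn (cycleKernel l m N) (Set.Ioc √N N)) :
    Tendsto (fun N => (∫ t in Set.Ioc √N N, cycleKernel l m N t) / l √N ^ (2 * m)) atTop atTop := by
  rw [tendsto_atTop]
  intro B
  -- With `A = exp L`, the window `(s, As]` contributes `log A = L` times the loss `exp (-2m)` from
  -- the `2m` factors of `l`, hence `|B| + 1`. The Potter exponent `1/(1+L)` makes the constant `exp
  -- ε * A ^ ε` exactly `e`.
  obtain ⟨L, hL⟩ : ∃ L : ℝ, L = Real.exp (2 * m) * (|B| + 1) := ⟨_, rfl⟩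
  have L0 : 0 < L := by rw [hL]; positivity
  obtain ⟨M, hP⟩ := hl.potter (ε := 1 / (1 + L)) (by positivity)
  obtain ⟨A, hA⟩ : ∃ A : ℝ, A = Real.exp L := ⟨_, rfl⟩
  have A1 : 1 ≤ A := by rw [hA]; exact Real.one_le_exp L0.le
  have A0 : 0 < A := by linarith
  have hK : Real.exp (1 / (1 + L)) * A ^ (1 / (1 + L)) = Real.exp 1 := by
    rw [hA, ← Real.exp_mul, ← Real.exp_add]
    congr 1
    field_simp
  filter_upwards [hI, Real.tendsto_sqrt_atTop.eventually_ge_atTop (A * M),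
    eventually_gt_atTop 0] with N hIN hsA N0
  have M1 := hP.1
  obtain ⟨s, hs⟩ : ∃ s : ℝ, s = √N := ⟨_, rfl⟩
  have hNs : N = s * s := by rw [hs, Real.mul_self_sqrt N0.le]
  rw [← hs] at hsA hIN ⊢
  have hAM : M ≤ A * M := by nlinarith
  have hMA : A ≤ A * M := by nlinarith
  have s0 : 0 < s := by linarith
  have ls := (hP.2 s (by linarith)).1
  have hend : A * s ≤ N := by rw [hNs]; nlinarith
  have hratio : ∀ x y : ℝ, M ≤ x → x ≤ y → y ≤ A * x →
      l y ≤ Real.exp 1 * l x ∧ l x ≤ Real.exp 1 * l y := by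
    intro x y hx hxy hy
    have x0 : 0 < x := by linarith
    have hlx := (hP.2 x hx).1
    have hly := (hP.2 y (hx.trans hxy)).1
    have : (y / x) ^ (1 / (1 + L)) ≤ A ^ (1 / (1 + L)) := by
      have h1 : y / x ≤ A := by rw [div_le_iff₀ x0]; exact hy
      exact Real.rpow_le_rpow (div_nonneg (by linarith) x0.le) h1 (by positivity)
    obtain ⟨h1, h2⟩ := (hP.2 x hx).2 y hxy
    rw [← hK]
    exact ⟨h1.trans (by gcongr), h2.trans (by gcongr)⟩
  rw [le_div_iff₀ (by positivity)]
  have hinv : IntegrableOn (fun t : ℝ => t⁻¹ * ((l s / Real.exp 1) ^ m * (l s / Real.exp 1) ^ m))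
      (Set.Ioc s (A * s)) := by
    have h1 : IntervalIntegrable (fun t : ℝ => t⁻¹) volume s (A * s) :=
      intervalIntegral.intervalIntegrable_inv (fun x hx => by
        rw [Set.uIcc_of_le (by nlinarith)] at hx
        exact (s0.trans_le hx.1).ne') continuousOn_id
    rw [intervalIntegrable_iff_integrableOn_Ioc_of_le (by nlinarith)] at h1
    exact h1.mul_const _
  calc B * l s ^ (2 * m) ≤ (|B| + 1) * l s ^ (2 * m) := by
        gcongr; linarith [le_abs_self B]
    _ = Real.log A * ((l s / Real.exp 1) ^ m * (l s / Real.exp 1) ^ m) := by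
        rw [hA, Real.log_exp, hL, ← pow_add, ← two_mul, div_pow, ← Real.exp_nat_mul]
        push_cast
        field_simp
    _ = ∫ t in Set.Ioc s (A * s), t⁻¹ * ((l s / Real.exp 1) ^ m * (l s / Real.exp 1) ^ m) := by
        rw [integral_mul_const, ← intervalIntegral.integral_of_le (by nlinarith),
          integral_inv_of_pos s0 (by positivity), mul_div_cancel_right₀ _ s0.ne']
    _ ≤ ∫ t in Set.Ioc s (A * s), cycleKernel l m N t := by
        refine setIntegral_mono_on hinv (hIN.mono_set (Set.Ioc_subset_Ioc_right hend))
          measurableSet_Ioc fun t ht => ?_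
        have t0 : 0 < t := s0.trans ht.1
        have hlow : M ≤ N / t := by
          rw [le_div_iff₀ t0, hNs]
          calc M * t ≤ M * (A * s) := by gcongr; exact ht.2
            _ = (A * M) * s := by ring
            _ ≤ s * s := by gcongr
        have e1 : l s / Real.exp 1 ≤ l t := by
          rw [div_le_iff₀' (Real.exp_pos 1)]
          exact (hratio s t (by linarith) ht.1.le ht.2).2
        have e2 : l s / Real.exp 1 ≤ l (N / t) := by
          rw [div_le_iff₀' (Real.exp_pos 1)]
          refine (hratio (N / t) s hlow ?_ ?_).1
          · rw [div_le_iff₀ t0, hNs]; gcongr; exact ht.1.le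
          · rw [← mul_div_assoc, le_div_iff₀ t0, hNs]
            calc s * t ≤ s * (A * s) := by gcongr; exact ht.2
              _ = A * (s * s) := by ring
        have e4 : 0 ≤ l s / Real.exp 1 := by positivity
        have e5 : 0 ≤ l t := e4.trans e1
        unfold cycleKernel
        gcongr
    _ ≤ _ := by
        refine setIntegral_mono_set hIN ?_ (Set.Ioc_subset_Ioc_right hend).eventuallyLE
        filter_upwards [ae_restrict_mem measurableSet_Ioc] with t ht
        exact cycleKernel_nonneg hl0 m (by linarith [ht.1]) ht.2

/-! ### Assembling the asymptotics -/

theorem pow_le_mul_choose {n k : ℕ} (hn : 2 * k ≤ n) :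
    (2 ^ k * (k.factorial : ℝ))⁻¹ * (n : ℝ) ^ k ≤ n.choose k := by
  have h1 : ((n + 1 - k : ℕ) : ℝ) ^ k ≤ (k.factorial : ℝ) * n.choose k := by
    have := Nat.pow_sub_le_descFactorial n k
    rw [Nat.descFactorial_eq_factorial_mul_choose] at this
    exact_mod_cast this
  have h2 : (n : ℝ) / 2 ≤ ((n + 1 - k : ℕ) : ℝ) := by
    rw [div_le_iff₀ two_pos]
    have : n ≤ (n + 1 - k) * 2 := by omega
    exact_mod_cast this
  have h3 : ((n : ℝ) / 2) ^ k ≤ (k.factorial : ℝ) * n.choose k :=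
    (pow_le_pow_left₀ (by positivity) h2 k).trans h1
  have hk : (0 : ℝ) < k.factorial := by exact_mod_cast k.factorial_pos
  rw [inv_mul_le_iff₀ (by positivity), mul_assoc]
  rw [div_pow, div_le_iff₀ (by positivity)] at h3
  linarith

namespace RankOne

variable {τ : ℝ} {l : ℝ → ℝ} {ε M : ℝ}

/-- The tail at `√n` is at most of the order of its regularly varying bound at `√(nμ)`. -/
theorem exists_tail_sqrt_le [IsProbabilityMeasure (weightLaw τ l)] (hl : Measurable l)
    (hP : PotterBound l ε M) (hτ : ε < τ - 1) {μ : ℝ} (hμ : 1 ≤ μ) :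
    ∃ C : ℝ, 0 < C ∧ ∀ x, M ≤ √x →
      tail τ l √x ≤ C * (√(x * μ) ^ (1 - τ) * l √(x * μ)) := by
  have hτ' : 0 < τ - 1 - ε := by linarith
  have m0 : 0 < √μ := Real.sqrt_pos.2 (by linarith)
  have m1 : 1 ≤ √μ := Real.one_le_sqrt.2 hμ
  refine ⟨Real.exp ε / (τ - 1 - ε) * (√μ ^ (τ - 1) * (Real.exp ε * √μ ^ ε)), by positivity,
    fun x hx => ?_⟩
  have s0 : 0 < √x := by linarith [hP.1]
  have x0 : 0 < x := Real.sqrt_pos.1 s0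
  have hs : √(x * μ) = √x * √μ := Real.sqrt_mul x0.le μ
  have h1 := ((hP.2 _ hx).2 (√(x * μ)) (by rw [hs]; nlinarith)).2
  have h2 : √(x * μ) / √x = √μ := by rw [hs]; field_simp
  rw [h2] at h1
  calc tail τ l √x ≤ Real.exp ε / (τ - 1 - ε) * (√x ^ (1 - τ) * l √x) := tail_le hl hP hτ hx
    _ ≤ Real.exp ε / (τ - 1 - ε) *
        (√x ^ (1 - τ) * (Real.exp ε * √μ ^ ε * l √(x * μ))) := by gcongr
    _ = _ := by
        have h3 : √(x * μ) ^ (1 - τ) * √μ ^ (τ - 1) = √x ^ (1 - τ) := by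
          rw [hs, Real.mul_rpow s0.le m0.le, mul_assoc, ← Real.rpow_add m0]
          simp
        rw [← h3]
        ring

end RankOne

open RankOne in
theorem theorem2p3 (τ : ℝ) (hτ2 : 2 < τ) (hτ3 : τ < 3)
    (l : ℝ → ℝ) (hl : SlowlyVarying l) (hl0 : ∀ h : ℝ, 1 ≤ h → 0 ≤ l h)
    [IsProbabilityMeasure (RankOne.weightLaw τ l)]
    (k : ℕ) (hk : Even k) (hk4 : 4 ≤ k)
    (hint : LocallyIntegrableOn (fun h : ℝ => l h ^ (k / 2)) (Set.Ici 1) volume) :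
    AsympGE (fun n => RankOne.avgCycles τ l k n)
      (fun n => (n : ℝ) ^ k * RankOne.tail τ l (√(n : ℝ)) ^ k *
        ∫ h in √(n * RankOne.meanWeight τ l)..n * RankOne.meanWeight τ l,
          1 / h * (l h ^ (k / 2) * l (n * RankOne.meanWeight τ l / h) ^ (k / 2) /
            l (√(n * RankOne.meanWeight τ l)) ^ k)) ∧
    (fun n => RankOne.avgCliques τ l k n) =o[atTop] (fun n => RankOne.avgCycles τ l k n) := by
  obtain ⟨m, hm⟩ : ∃ m, k = 2 * m := hk.exists_two_nsmul k |>.imp fun m h => by simpa using h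
  subst hm
  have hk2 : 2 * m / 2 = m := by omega
  rw [hk2] at hint ⊢
  have : NeZero (2 * m) := ⟨by omega⟩
  have hlm := hl.measurable
  -- With `a = τ-1+2ε` and `b = τ-1-2ε`, the triangle bound needs `2a - 2 ≤ b`, i.e. `6ε ≤ 3 - τ`,
  -- and the finite mean needs `ε < τ - 2`. An eighth leaves room for these and the weaker
  -- constraints.
  obtain ⟨ε, hε⟩ : ∃ ε : ℝ, ε = min (τ - 2) (3 - τ) / 8 := ⟨_, rfl⟩
  have ε0 : 0 < ε := by rw [hε]; exact div_pos (lt_min (by linarith) (by linarith)) (by norm_num)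
  have hε2 : 8 * ε ≤ τ - 2 := by rw [hε]; linarith [min_le_left (τ - 2) (3 - τ)]
  have hε3 : 8 * ε ≤ 3 - τ := by rw [hε]; linarith [min_le_right (τ - 2) (3 - τ)]
  obtain ⟨M, hP⟩ : ∃ M, PotterBound l ε M := hl.potter ε0
  have M1 := hP.1
  have hμ1 : 1 ≤ meanWeight τ l := one_le_meanWeight hlm hP (by linarith)
  set μ := meanWeight τ l with hμ
  have μ0 : 0 < μ := by linarith
  obtain ⟨c₁, hc₁, hcyc⟩ := exists_mul_integral_cycleKernel_le (τ := τ) hlm hl0 hP ε0.le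
    (by linarith) hint
  obtain ⟨C₂, hC₂, htail⟩ := exists_tail_sqrt_le (τ := τ) hlm hP (by linarith) hμ1
  obtain ⟨C₃, hC₃, hclq⟩ := exists_lintegral_twoPower_le (τ := τ) (a := τ - 1 + 2 * ε)
    (b := τ - 1 - 2 * ε) hlm hP (by linarith) ε0.le (by linarith) (by linarith)
  obtain ⟨c₄, hc₄⟩ : ∃ c : ℝ, c = (2 ^ (2 * m) * ((2 * m).factorial : ℝ))⁻¹ := ⟨_, rfl⟩
  have c₄0 : 0 < c₄ := by
    have : (0 : ℝ) < (2 * m).factorial := by exact_mod_cast (2 * m).factorial_pos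
    rw [hc₄]; positivity
  set D : ℕ → ℝ := fun n => (√(n * μ) ^ (1 - τ) * l √(n * μ)) ^ (2 * m) with hD
  set J : ℝ → ℝ := fun N => (∫ t in Set.Ioc √N N, cycleKernel l m N t) / l √N ^ (2 * m) with hJ
  have hJtop : Tendsto J atTop atTop := hl.tendsto_integral_cycleKernel hl0
    ((eventually_ge_atTop _).mono fun N hN => (hcyc N hN).1)
  have hNtop : Tendsto (fun n : ℕ => (n : ℝ) * μ) atTop atTop :=
    tendsto_natCast_atTop_atTop.atTop_mul_const μ0
  have hsn : ∀ᶠ n : ℕ in atTop, M ≤ √(n : ℝ) :=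
    (Real.tendsto_sqrt_atTop.comp tendsto_natCast_atTop_atTop).eventually_ge_atTop M
  have hsN : ∀ᶠ n : ℕ in atTop, M ≤ √(n * μ) :=
    (Real.tendsto_sqrt_atTop.comp hNtop).eventually_ge_atTop M
  have hDpos : ∀ᶠ n : ℕ in atTop, 0 < D n := hsN.mono fun n hn => by
    have h1 : 0 < √(n * μ) := by linarith
    have h2 := (hP.2 _ hn).1
    simp only [hD]; positivity
  have hJpos : ∀ᶠ n : ℕ in atTop, 0 < J (n * μ) := (hJtop.comp hNtop).eventually_gt_atTop 0
  have hcycles : ∀ᶠ n : ℕ in atTop,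
      c₄ * c₁ * ((n : ℝ) ^ (2 * m) * D n * J (n * μ)) ≤ avgCycles τ l (2 * m) n := by
    filter_upwards [hNtop.eventually_ge_atTop (4 * M ^ 2), hsN, hDpos, hJpos,
      eventually_ge_atTop (2 * (2 * m))] with n hn hs hd hj hnk
    have hls := (hP.2 _ hs).1
    have N0 : 0 < μ * n := by rw [mul_comm]; exact lt_of_lt_of_le (by positivity) hn
    have h1 := (hcyc _ hn).2
    have h2 : c₁ * (√(n * μ) ^ (1 - τ)) ^ (2 * m) *
        ∫ t in Set.Ioc √(n * μ) (n * μ), cycleKernel l m (n * μ) t = c₁ * (D n * J (n * μ)) := by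
      simp only [hD, hJ]
      rw [mul_pow]
      field_simp
    rw [h2] at h1
    have h3 := le_avgCycles (τ := τ) (l := l) (k := 2 * m) (n := n) (by omega)
      (c := c₁ * (D n * J (n * μ))) fun f hf => h1.trans
        -- The bound for the weights alone passes to the graph, since large consecutive products
        -- force the cycle.
        (ENNReal.toReal_mono (measure_ne_top _ _) (by
          rw [mul_comm (n : ℝ) μ]
          exact pi_weightLaw_le_cycle (by omega) N0 hf))
    refine le_trans ?_ h3
    calc c₄ * c₁ * ((n : ℝ) ^ (2 * m) * D n * J (n * μ))
        = c₄ * (n : ℝ) ^ (2 * m) * (c₁ * (D n * J (n * μ))) := by ring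
      _ ≤ _ := by
          gcongr
          rw [hc₄]; exact pow_le_mul_choose hnk
  have hcliques : ∀ᶠ n : ℕ in atTop,
      avgCliques τ l (2 * m) n ≤ (n : ℝ) ^ (2 * m) * (C₃ ^ (2 * m) * D n) := by
    filter_upwards [hsN] with n hs
    have hls := (hP.2 _ hs).1
    have s0 : 0 < √(n * μ) := by linarith
    have N0 : 0 < μ * n := by rw [mul_comm]; exact Real.sqrt_pos.1 s0
    have h1 := avgCliques_le (τ := τ) (l := l) (k := 2 * m) (n := n)
      (c := (C₃ * (√(n * μ) ^ (1 - τ) * l √(n * μ))) ^ (2 * m)) fun f hf => by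
        refine ENNReal.toReal_le_of_le_ofReal (by positivity) ?_
        refine (clique_le_twoPower hk4 N0 hf (a := τ - 1 + 2 * ε) (b := τ - 1 - 2 * ε)
          (by linarith) (by linarith) (by linarith) (by linarith)).trans ?_
        rw [ENNReal.ofReal_pow (by positivity), mul_comm μ (n : ℝ)]
        gcongr
        exact hclq _ hs
    refine h1.trans ?_
    simp only [hD]
    rw [← mul_pow C₃]
    gcongr
    exact_mod_cast Nat.choose_le_pow n (2 * m)
  have hintegral : ∀ᶠ n : ℕ in atTop, ∫ h in √(n * μ)..n * μ,
      1 / h * (l h ^ m * l (n * μ / h) ^ m / l (√(n * μ)) ^ (2 * m)) = J (n * μ) := by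
    filter_upwards [hsN] with n hs
    have hle : √(n * μ) ≤ n * μ := by
      have h1 : 1 ≤ √(n * μ) := M1.trans hs
      have h2 : 0 ≤ (n : ℝ) * μ := by positivity
      nlinarith [Real.mul_self_sqrt h2]
    rw [intervalIntegral.integral_of_le hle]
    simp only [hJ]
    rw [← integral_div]
    congr 1
    funext h
    unfold cycleKernel
    ring
  constructor
  · refine ⟨c₄ * c₁ / C₂ ^ (2 * m), by positivity, ?_⟩
    refine le_liminf_of_le (by isBoundedDefault) ?_
    filter_upwards [hcycles, hintegral, hsn, hDpos, hJpos, eventually_gt_atTop 0]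
      with n hc hi hs hd hj hn0
    rw [hi]
    have ht := tail_pos (τ := τ) hlm hP ε0.le (by linarith) hs
    have hn : (0 : ℝ) < n := by exact_mod_cast hn0
    rw [EReal.coe_le_coe_iff, div_le_div_iff₀ (by positivity) (by positivity)]
    have h1 : tail τ l √(n : ℝ) ^ (2 * m) ≤ C₂ ^ (2 * m) * D n := by
      simp only [hD]
      rw [← mul_pow]
      exact pow_le_pow_left₀ ht.le (htail _ hs) _
    calc c₄ * c₁ * ((n : ℝ) ^ (2 * m) * tail τ l √(n : ℝ) ^ (2 * m) * J (n * μ))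
        ≤ c₄ * c₁ * ((n : ℝ) ^ (2 * m) * (C₂ ^ (2 * m) * D n) * J (n * μ)) := by gcongr
      _ = c₄ * c₁ * ((n : ℝ) ^ (2 * m) * D n * J (n * μ)) * C₂ ^ (2 * m) := by ring
      _ ≤ _ := by gcongr
  · rw [Asymptotics.isLittleO_iff]
    intro δ hδ
    -- The common factor `n^k D` cancels, so it is enough that `J` eventually exceeds the ratio of
    -- the two constants divided by `δ`.
    filter_upwards [hcycles, hcliques, hDpos, hJpos,
      (hJtop.comp hNtop).eventually_ge_atTop (C₃ ^ (2 * m) / (δ * (c₄ * c₁)))]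
      with n hc hq hd hj hjδ
    have hA0 : 0 ≤ avgCliques τ l (2 * m) n := integral_nonneg fun ω => Nat.cast_nonneg _
    rw [Function.comp_apply, div_le_iff₀ (by positivity)] at hjδ
    rw [Real.norm_of_nonneg hA0]
    calc avgCliques τ l (2 * m) n ≤ (n : ℝ) ^ (2 * m) * (C₃ ^ (2 * m) * D n) := hq
      _ ≤ (n : ℝ) ^ (2 * m) * (J (n * μ) * (δ * (c₄ * c₁)) * D n) := by gcongr
      _ = δ * (c₄ * c₁ * ((n : ℝ) ^ (2 * m) * D n * J (n * μ))) := by ring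
      _ ≤ δ * ‖avgCycles τ l (2 * m) n‖ := by
          gcongr
          exact hc.trans (le_abs_self _)
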